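/- Let $\mathcal H$ be a complex Hilbert space and $\pi:\mathrm U(1)\to\mathcal U(\mathcal H)$ a strongly continuous unitary representation with charge operator $X$, i.e. $\pi(e^{i\alpha})=\exp(i\alpha X)$. For $\mu\in\mathbb Z$ let $X^{(\mu)}$ be the orthogonal projection onto $\mathcal H^{(\mu)}=\{\psi\in D(X): X\psi=\mu\psi\}$. Assume that every $\mathcal H^{(\mu)}$ is finite-dimensional and that $\mathcal H^{(\mu)}=\{0\}$ for $\mu<0$. Let $D_X$ be the set of all $\psi\in\mathcal H$ with $X^{(\mu)}\psi=0$ for all but finitely many $\mu$, and let $\mathcal{SU}(X)$ be the group of unitaries $U$ that commute with all $\pi(z)$ and satisfy $\det\big(X^{(\mu)}UX^{(\mu)}|_{\mathcal H^{(\mu)}}\big)=1$ for all $\mu$. A selfadjoint operator commutes with $X$ if it commutes with all the projections $X^{(\mu)}$ (domains included). The dynamical group generated by selfadjoint operators $A_1,\dots,A_m$ is the smallest subgroup of $\mathcal U(\mathcal H)$ that is closed in the strong operator topology of $\mathcal U(\mathcal H)$ and contains all $\exp(itA_k)$, $t\in\mathbb R$. A selfadjoint operator $H$ with domain $D(H)$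 is called complementary to $X$ if there are mutually orthogonal projections $E_-,E_0,E_+$ with $E_-+E_0+E_+=\mathbb 1$, commuting with all $X^{(\mu)}$, such that $X^{(\mu)}_\pm:=X^{(\mu)}E_\pm\neq0$ for all $\mu\ge1$, $X^{(0)}E_-=X^{(0)}$, and: 1. $E_0\mathcal H\subset D(H)$ and $H\psi=0$ for all $\psi\in E_0\mathcal H$; 2. $D_X\subset D(H)$, and for all integers $\mu\ge1$ and all $\psi\in D_X$ we have $HX_+^{(\mu+1)}\psi=X_-^{(\mu)}H\psi$; moreover $X_-^{(\mu)}HX_+^{(\mu+1)}$ is a (bounded) partial isometry with source projection $X_+^{(\mu+1)}$ and target projection $X_-^{(\mu)}$; 3. with $F=X^{(0)}+X_+^{(1)}$, the group generated by all $\exp(itH)$, $t\in\mathbb R$, and by those $U\in\mathcal{SU}(X)$ that commute with $F$ leaves $F\mathcal H$ invariant and acts transitively on the one-dimensional subspaces of $F\mathcal H$. Let $d\ge1$ and let $H_1,\dots,H_d$ be selfadjoint operators on $\mathcal H$ such that $H_1,\dots,H_{d-1}$ commute with $X$, the dynamical group generated by $H_1,\dots,H_{d-1}$ contains $\mathcal{SU}(X)$,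 and $H_d$ is complementary to $X$. Then the control system with Hamiltonians $H_0=\mathbb 1,H_1,\dots,H_d$ is pure-state controllable: for all unit vectors $\psi_0,\psi\in\mathcal H$ and every $\epsilon>0$ there are a finite time $T>0$ and piecewise constant real control functions $u_0,\dots,u_d$ on $[0,T]$, at most one of which is non-zero at each time, such that the resulting propagator $U(0,T)$, a finite product of unitaries $\exp(-i\tau u H_k)$ with $\tau>0$ the length of an interval of constancy and $u$ the value of the active control $u_k$ on it, satisfies $\|\psi-U(0,T)\psi_0\|<\epsilon$. -/

import Mathlib

noncomputable section

namespace QControl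

variable {E : Type*} [NormedAddCommGroup E] [InnerProductSpace ℂ E] [CompleteSpace E]

/-! ### Unbounded selfadjoint operators and the unitary groups they generate

An unbounded operator is a `LinearPMap`; it is selfadjoint if `IsSelfAdjoint`, i.e. if it is
densely defined and equal to its adjoint, including domains. -/

/-- A family of unitaries is strongly continuous. -/
def StronglyContinuous {T : Type*} [TopologicalSpace T] (U : T → unitary (E →L[ℂ] E)) : Prop :=
  ∀ ψ : E, Continuous fun t => (U t : E →L[ℂ] E) ψ

/-- A strongly continuous one-parameter group of unitaries. -/
structure IsUnitaryGroup (U : ℝ → unitary (E →L[ℂ] E)) : Prop where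
  map_zero : U 0 = 1
  map_add : ∀ s t, U (s + t) = U s * U t
  strongCont : StronglyContinuous U

/-- The generator `A` of `U`, with the convention `U t = exp (i t A)`: the domain consists of the
vectors `ψ` for which `t ↦ U t ψ` is differentiable at `0`, and `A ψ = -i (d/dt) U t ψ` at `0`. -/
def generator (U : ℝ → unitary (E →L[ℂ] E)) : E →ₗ.[ℂ] E where
  domain :=
    { carrier := {ψ | DifferentiableAt ℝ (fun t => (U t : E →L[ℂ] E) ψ) 0}
      add_mem' := by
        intro a b ha hb
        simpa only [Set.mem_ofPred_eq, map_add] using DifferentiableAt.fun_add ha hb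
      zero_mem' := by simp
      smul_mem' := by
        intro c a ha
        simpa only [Set.mem_ofPred_eq, map_smul] using DifferentiableAt.fun_const_smul ha c }
  toFun :=
    { toFun := fun ψ => -Complex.I • deriv (fun t => (U t : E →L[ℂ] E) (ψ : E)) 0
      map_add' := by
        rintro ⟨a, ha⟩ ⟨b, hb⟩
        have h := deriv_fun_add (𝕜 := ℝ) (F := E) ha hb
        simp only [Submodule.coe_add, map_add]
        rw [h, smul_add]
      map_smul' := by
        rintro c ⟨a, ha⟩
        have h := deriv_fun_const_smul (𝕜 := ℝ) (F := E) c ha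
        simp only [Submodule.coe_smul, map_smul, RingHom.id_apply]
        rw [h, smul_comm] }

open Classical in
/-- `expI A t = exp (i t A)` for a selfadjoint operator `A`: the strongly continuous one-parameter
unitary group with generator `A`, which exists and is unique by Stone's theorem. (The value is `1`
if there is no such group, which does not occur for selfadjoint `A`.) -/
def expI (A : E →ₗ.[ℂ] E) (t : ℝ) : unitary (E →L[ℂ] E) :=
  if h : ∃ U : ℝ → unitary (E →L[ℂ] E), IsUnitaryGroup U ∧ generator U = A then h.choose t else 1

/-- The identity operator, with all of `E` as its domain. -/
def idOp : E →ₗ.[ℂ] E := (LinearMap.id : E →ₗ[ℂ] E).toPMap ⊤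

/-! ### The dynamical group -/

/-- A set of unitaries is closed in the restriction of the strong operator topology to the
unitary group. -/
def IsStronglyClosed (S : Set (unitary (E →L[ℂ] E))) : Prop :=
  ∀ U : unitary (E →L[ℂ] E),
    (∀ (s : Finset E) (ε : ℝ), 0 < ε →
      ∃ V ∈ S, ∀ ψ ∈ s, ‖(V : E →L[ℂ] E) ψ - (U : E →L[ℂ] E) ψ‖ < ε) → U ∈ S

/-- The dynamical group generated by a family of Hamiltonians: the smallest strongly closed
subgroup of the unitary group that contains all `exp (i t A k)`. -/
def dynamicalGroup {ι : Type*} (A : ι → E →ₗ.[ℂ] E) : Subgroup (unitary (E →L[ℂ] E)) :=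
  sInf {G | IsStronglyClosed (G : Set (unitary (E →L[ℂ] E))) ∧ ∀ k t, expI (A k) t ∈ G}

/-! ### Control systems and pure-state controllability -/

/-- A time interval of length `duration` on which only the control `index` is switched on, with
constant value `amplitude`. -/
structure Pulse (ι : Type*) where
  index : ι
  amplitude : ℝ
  duration : ℝ
  duration_pos : 0 < duration

/-- The time evolution `U(0,T)` under a piecewise constant control, given as the list of its
pulses, first pulse first. -/
def propagator {ι : Type*} (A : ι → E →ₗ.[ℂ] E) : List (Pulse ι) → unitary (E →L[ℂ] E)
  | [] => 1
  | p :: ps => propagator A ps * expI (A p.index) (-(p.duration * p.amplitude))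

/-- `ψ` is reachable from `ψ₀`: it can be approximated up to any error in a finite time `T > 0`. -/
def Reachable {ι : Type*} (A : ι → E →ₗ.[ℂ] E) (ψ₀ ψ : E) : Prop :=
  ∀ ε : ℝ, 0 < ε → ∃ ps : List (Pulse ι), ps ≠ [] ∧
    ‖ψ - (propagator A ps : E →L[ℂ] E) ψ₀‖ < ε

/-- Every pure state is reachable from every other one. -/
def PureStateControllable {ι : Type*} (A : ι → E →ₗ.[ℂ] E) : Prop :=
  ∀ ψ₀ ψ : E, ‖ψ₀‖ = 1 → ‖ψ‖ = 1 → Reachable A ψ₀ ψ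

/-! ### The charge operator of a representation of `U(1)` -/

/-- The charge operator `X` of a representation `π` of `U(1)`: `π (e^{iα}) = exp (i α X)`. -/
def charge (π : Circle →* unitary (E →L[ℂ] E)) : E →ₗ.[ℂ] E :=
  generator fun α : ℝ => π (Circle.exp α)

/-- The eigenspace `{ψ ∈ D(A) | A ψ = c ψ}` of an operator. -/
def eigenspace (A : E →ₗ.[ℂ] E) (c : ℂ) : Submodule ℂ E :=
  A.graph.comap (LinearMap.id.prod (c • LinearMap.id))

/-- The eigenspace of the charge operator belonging to `μ`. -/
def sector (π : Circle →* unitary (E →L[ℂ] E)) (μ : ℤ) : Submodule ℂ E :=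
  eigenspace (charge π) (μ : ℂ)

/-- The eigenprojection `X^(μ)` of the charge operator. -/
def sectorProj (π : Circle →* unitary (E →L[ℂ] E)) [∀ μ, FiniteDimensional ℂ (sector π μ)]
    (μ : ℤ) : E →L[ℂ] E :=
  (sector π μ).starProjection

/-- The space `D_X` of finite particle vectors. -/
def IsFiniteParticle (π : Circle →* unitary (E →L[ℂ] E)) [∀ μ, FiniteDimensional ℂ (sector π μ)]
    (ψ : E) : Prop :=
  {μ : ℤ | sectorProj π μ ψ ≠ 0}.Finite

/-- A selfadjoint operator `A` commutes with the charge operator: it commutes (including domains)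
with all the eigenprojections of the charge operator, `X^(μ) A ⊆ A X^(μ)`. -/
def CommutesWithCharge (π : Circle →* unitary (E →L[ℂ] E))
    [∀ μ, FiniteDimensional ℂ (sector π μ)] (A : E →ₗ.[ℂ] E) : Prop :=
  ∀ (μ : ℤ) (ψ : A.domain), ∃ h : sectorProj π μ (ψ : E) ∈ A.domain,
    A ⟨sectorProj π μ (ψ : E), h⟩ = sectorProj π μ (A ψ)

/-- The block `U^(μ) = X^(μ) U X^(μ)` as an operator on the eigenspace. -/
def block (π : Circle →* unitary (E →L[ℂ] E)) [∀ μ, FiniteDimensional ℂ (sector π μ)]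
    (U : unitary (E →L[ℂ] E)) (μ : ℤ) : sector π μ →ₗ[ℂ] sector π μ :=
  (((sector π μ).orthogonalProjectionOnto ∘L (U : E →L[ℂ] E)) ∘L (sector π μ).subtypeL :
    sector π μ →L[ℂ] sector π μ)

/-- `SU(X)`: the unitaries that commute with all `π z` and all of whose blocks have
determinant `1`. -/
def specialUnitary (π : Circle →* unitary (E →L[ℂ] E)) [∀ μ, FiniteDimensional ℂ (sector π μ)] :
    Set (unitary (E →L[ℂ] E)) :=
  {U | (∀ z, Commute U (π z)) ∧ ∀ μ, LinearMap.det (block π U μ) = 1}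

/-! ### Operators complementary to the charge operator -/

/-- An orthogonal decomposition `E = E₋ ⊕ E₀ ⊕ E₊`, given by the projections `minus`, `zero` and
`plus`, that is compatible with the charge operator. -/
structure Splitting (π : Circle →* unitary (E →L[ℂ] E))
    [∀ μ, FiniteDimensional ℂ (sector π μ)] where
  minus : E →L[ℂ] E
  zero : E →L[ℂ] E
  plus : E →L[ℂ] E
  minus_proj : IsStarProjection minus
  zero_proj : IsStarProjection zero
  plus_proj : IsStarProjection plus
  minus_mul_zero : minus * zero = 0
  minus_mul_plus : minus * plus = 0
  zero_mul_plus : zero * plus = 0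
  sum_eq_one : minus + zero + plus = 1
  minus_comm : ∀ μ, Commute minus (sectorProj π μ)
  zero_comm : ∀ μ, Commute zero (sectorProj π μ)
  plus_comm : ∀ μ, Commute plus (sectorProj π μ)
  minus_ne_zero : ∀ μ : ℤ, 1 ≤ μ → sectorProj π μ * minus ≠ 0
  plus_ne_zero : ∀ μ : ℤ, 1 ≤ μ → sectorProj π μ * plus ≠ 0
  minus_sector_zero : sectorProj π 0 * minus = sectorProj π 0

variable {π : Circle →* unitary (E →L[ℂ] E)} [∀ μ, FiniteDimensional ℂ (sector π μ)]

/-- `X₋^(μ) = X^(μ) E₋`. -/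
def Splitting.Xminus (S : Splitting π) (μ : ℤ) : E →L[ℂ] E := sectorProj π μ * S.minus

/-- `X₊^(μ) = X^(μ) E₊`. -/
def Splitting.Xplus (S : Splitting π) (μ : ℤ) : E →L[ℂ] E := sectorProj π μ * S.plus

/-- The projection `F = X^(0) ⊕ X₊^(1)`. -/
def Splitting.F (S : Splitting π) : E →L[ℂ] E := sectorProj π 0 + S.Xplus 1

/-- The group generated by all `exp (i t A)` and by those elements of `SU(X)` that commute
with `F`. -/
def Splitting.lowGroup (S : Splitting π) (A : E →ₗ.[ℂ] E) : Subgroup (unitary (E →L[ℂ] E)) :=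
  Subgroup.closure
    (Set.range (expI A) ∪ {U | U ∈ specialUnitary π ∧ Commute (U : E →L[ℂ] E) S.F})

/-- The selfadjoint operator `A` is complementary to the charge operator, with respect to a given
splitting. -/
structure Splitting.IsCompl (S : Splitting π) (A : E →ₗ.[ℂ] E) : Prop where
  /-- `A` is defined on, and vanishes on, the range of the projection `E₀`. -/
  zero_on : ∀ ψ : E, S.zero ψ = ψ → ∃ h : ψ ∈ A.domain, A ⟨ψ, h⟩ = 0
  /-- The finite particle vectors belong to the domain of `A`. -/
  finiteParticle_mem : ∀ ψ : E, IsFiniteParticle π ψ → ψ ∈ A.domain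
  /-- `A X₊^(μ+1) ψ = X₋^(μ) A ψ` for finite particle vectors `ψ`. -/
  intertwine : ∀ μ : ℤ, 1 ≤ μ → ∀ ψ : A.domain, IsFiniteParticle π (ψ : E) →
    ∃ h : S.Xplus (μ + 1) (ψ : E) ∈ A.domain,
      A ⟨S.Xplus (μ + 1) (ψ : E), h⟩ = S.Xminus μ (A ψ)
  /-- `X₋^(μ) A X₊^(μ+1)` is a bounded operator `V`, and a partial isometry with source projection
  `X₊^(μ+1)` and target projection `X₋^(μ)`. -/
  partialIsometry : ∀ μ : ℤ, 1 ≤ μ → ∃ V : E →L[ℂ] E,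
    (∀ ψ : E, ∃ h : S.Xplus (μ + 1) ψ ∈ A.domain,
      V ψ = S.Xminus μ (A ⟨S.Xplus (μ + 1) ψ, h⟩)) ∧
    star V * V = S.Xplus (μ + 1) ∧ V * star V = S.Xminus μ
  /-- The group `lowGroup` acts on the range of `F` ... -/
  lowGroup_invariant : ∀ U ∈ S.lowGroup A, ∀ ψ : E, S.F ψ = ψ →
    S.F ((U : E →L[ℂ] E) ψ) = (U : E →L[ℂ] E) ψ
  /-- ... and it acts transitively on the one-dimensional subspaces of the range of `F`. -/
  lowGroup_transitive : ∀ φ ψ : E, ‖φ‖ = 1 → ‖ψ‖ = 1 → S.F φ = φ → S.F ψ = ψ →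
    ∃ U ∈ S.lowGroup A, ∃ c : ℂ, ‖c‖ = 1 ∧ (U : E →L[ℂ] E) φ = c • ψ

/-- The operator `A` is complementary to the charge operator of `π`. -/
def IsComplementary (π : Circle →* unitary (E →L[ℂ] E)) [∀ μ, FiniteDimensional ℂ (sector π μ)]
    (A : E →ₗ.[ℂ] E) : Prop :=
  ∃ S : Splitting π, S.IsCompl A

end QControl

end

noncomputable section

namespace QControl

variable {E : Type*} [NormedAddCommGroup E] [InnerProductSpace ℂ E] [CompleteSpace E]

/-! ### One-parameter groups and their generators -/

/-! Let `G` be the strong closure of the group generated by the one-parameter groups of all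
Hamiltonians, including the identity. Reachability may be tested with `G`, since propagators exhaust
the unclosed group, and minimality of the dynamical group puts `SU(X)` inside `G`. Fix a unit vector
`χ` in the range of `F`. If `U₀ ψ₀` and `U₁ ψ` are both close to `χ`, then `U₁⁻¹ U₀ ψ₀` is close to
`ψ`. Finite particle vectors are dense, because Fourier analysis on the circle makes the sectors
total, so it suffices to steer each of them exactly to a multiple of `χ`
(`IsCompl.exists_apply_eq`).

This is a descent on the highest charge. Products of two reflections lie in `SU(X)` and turn each
component of positive charge into the range of `X₊^(μ)` (`exists_specialUnitary_rotation`). A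
quarter period of the complementary operator then lowers every charge `μ ≥ 2` by one and keeps the
range of `F` invariant (`IsCompl.exists_lowering`). Once the vector lies in the range of `F`, the
assumed transitivity reaches `χ` up to a phase, which the identity Hamiltonian removes.

The quarter period can be computed because the complementary operator `A` is bounded
(`IsCompl.exists_eq_toPMap`). It is isometric on the part complementary to `F` and `E₀`, zero on the
range of `E₀`, and bounded on the finite-dimensional sectors of charge 0 and 1. Hence `exp (i t A)`
comes from the norm exponential, and on a pair of vectors exchanged by `A` the time `π/2` is an
exchange up to the factor `i`. -/

theorem norm_unitary_apply (U : unitary (E →L[ℂ] E)) (ψ : E) : ‖(U : E →L[ℂ] E) ψ‖ = ‖ψ‖ :=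
  (Unitary.linearIsometryEquiv U).norm_map ψ

theorem IsUnitaryGroup.hasDerivAt {U : ℝ → unitary (E →L[ℂ] E)} (hU : IsUnitaryGroup U)
    (ψ : (generator U).domain) (t : ℝ) :
    HasDerivAt (fun s => (U s : E →L[ℂ] E) (ψ : E))
      (Complex.I • (U t : E →L[ℂ] E) (generator U ψ)) t := by
  have h0 : DifferentiableAt ℝ (fun s => (U s : E →L[ℂ] E) (ψ : E)) 0 := ψ.2
  have h1 : Complex.I • generator U ψ = deriv (fun s => (U s : E →L[ℂ] E) (ψ : E)) 0 := by
    change Complex.I • (-Complex.I • deriv (fun s => (U s : E →L[ℂ] E) (ψ : E)) 0) = _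
    rw [smul_smul]; simp
  have h2 : HasDerivAt (fun s => (U s : E →L[ℂ] E) (ψ : E)) (Complex.I • generator U ψ) (t - t) := by
    rw [h1, sub_self]; exact h0.hasDerivAt
  have h3 := h2.comp_sub_const t t
  have h4 := (((U t : E →L[ℂ] E).restrictScalars ℝ).hasFDerivAt).comp_hasDerivAt t h3
  simp only [ContinuousLinearMap.coe_restrictScalars', map_smul] at h4
  refine h4.congr_of_eventuallyEq (Filter.Eventually.of_forall fun s => ?_)
  have := hU.map_add t (s - t)
  rw [add_sub_cancel] at this
  simp [this]

/-- The derivative of `exp (-i c t) U t ψ` vanishes identically. The argument applies to any group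
with this generator, so no uniqueness statement is needed. -/
theorem IsUnitaryGroup.apply_eigenvector {U : ℝ → unitary (E →L[ℂ] E)} (hU : IsUnitaryGroup U)
    (ψ : (generator U).domain) (c : ℝ) (h : generator U ψ = (c : ℂ) • (ψ : E)) (t : ℝ) :
    (U t : E →L[ℂ] E) (ψ : E) = Complex.exp (Complex.I * c * t) • (ψ : E) := by
  have hd : ∀ s : ℝ, HasDerivAt (fun s : ℝ => Complex.exp (-(Complex.I * c * s)) •
      (U s : E →L[ℂ] E) (ψ : E)) 0 s := by
    intro s
    have h1 := hU.hasDerivAt ψ s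
    have h2 : HasDerivAt (fun s : ℝ => Complex.exp (-(Complex.I * c * s)))
        (Complex.exp (-(Complex.I * c * s)) * -(Complex.I * c * 1)) s :=
      (((Complex.ofRealCLM.hasDerivAt (x := s)).const_mul (Complex.I * c)).neg).cexp
    convert! h2.smul h1 using 1
    rw [h, map_smul]
    module
  have hconst := is_const_of_deriv_eq_zero (fun s => (hd s).differentiableAt)
    (fun s => (hd s).deriv) t 0
  simp only [hU.map_zero, Complex.ofReal_zero, mul_zero, neg_zero, Complex.exp_zero, one_smul,
    OneMemClass.coe_one, one_apply_eq_self] at hconst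
  conv_rhs => rw [← hconst, smul_smul, ← Complex.exp_add, add_neg_cancel, Complex.exp_zero, one_smul]

/-- The norm exponential supplies the group. It guarantees that `expI` does not take its default
value `1` on bounded selfadjoint operators. -/
theorem exists_isUnitaryGroup_generator_eq (B : E →L[ℂ] E) (hB : IsSelfAdjoint B) :
    ∃ U : ℝ → unitary (E →L[ℂ] E), IsUnitaryGroup U ∧
      generator U = (B : E →ₗ[ℂ] E).toPMap ⊤ := by
  let b : ℝ → selfAdjoint (E →L[ℂ] E) := fun t => ⟨(t : ℂ) • B, by
    rw [selfAdjoint.mem_iff, star_smul, hB.star_eq]; simp⟩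
  have hcoe : ∀ t : ℝ, ((selfAdjoint.expUnitary (b t) : unitary (E →L[ℂ] E)) : E →L[ℂ] E) =
      NormedSpace.exp (t • (Complex.I • B)) := by
    intro t
    rw [selfAdjoint.expUnitary_coe]
    congr 1
    rw [smul_comm, ← Complex.coe_smul]
  have hderiv : ∀ (t : ℝ) (ψ : E), HasDerivAt (fun t : ℝ =>
      ((selfAdjoint.expUnitary (b t) : unitary (E →L[ℂ] E)) : E →L[ℂ] E) ψ)
      ((NormedSpace.exp (t • (Complex.I • B)) * (Complex.I • B)) ψ) t := by
    intro t ψ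
    simp only [hcoe]
    exact (((ContinuousLinearMap.apply ℂ E ψ).restrictScalars ℝ).hasFDerivAt).comp_hasDerivAt t
      (hasDerivAt_exp_smul_const (𝕂 := ℝ) (Complex.I • B) t)
  refine ⟨fun t => selfAdjoint.expUnitary (b t), ⟨?_, fun s t => ?_, fun ψ => ?_⟩, ?_⟩
  · ext1
    rw [hcoe, zero_smul, NormedSpace.exp_zero]; rfl
  · have : b (s + t) = b s + b t := Subtype.ext (by simp [b, add_smul])
    rw [this, Commute.expUnitary_add]
    exact ((Commute.refl B).smul_left (s : ℂ)).smul_right (t : ℂ)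
  · exact continuous_iff_continuousAt.2 fun t => (hderiv t ψ).continuousAt
  · refine LinearPMap.ext ?_ ?_
    · exact Submodule.ext fun ψ => ⟨fun _ => trivial, fun _ => (hderiv 0 ψ).differentiableAt⟩
    · intro ψ h1 h2
      change -Complex.I • deriv _ 0 = B ψ
      rw [(hderiv 0 ψ).deriv]
      simp [smul_smul]

theorem expI_zero (A : E →ₗ.[ℂ] E) : expI A 0 = 1 := by
  unfold expI
  split_ifs with h
  · exact h.choose_spec.1.map_zero
  · rfl

theorem expI_add (A : E →ₗ.[ℂ] E) (s t : ℝ) : expI A (s + t) = expI A s * expI A t := by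
  unfold expI
  split_ifs with h
  · exact h.choose_spec.1.map_add s t
  · simp

theorem expI_neg (A : E →ₗ.[ℂ] E) (t : ℝ) : expI A (-t) = (expI A t)⁻¹ := by
  rw [eq_inv_iff_mul_eq_one, ← expI_add, neg_add_cancel, expI_zero]

theorem expI_apply_eigenvector (B : E →L[ℂ] E) (hB : IsSelfAdjoint B) {ψ : E} {c : ℝ}
    (h : B ψ = (c : ℂ) • ψ) (t : ℝ) :
    (expI ((B : E →ₗ[ℂ] E).toPMap ⊤) t : E →L[ℂ] E) ψ =
      Complex.exp (Complex.I * c * t) • ψ := by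
  have hex := exists_isUnitaryGroup_generator_eq B hB
  unfold expI
  rw [dif_pos hex]
  obtain ⟨hU, hgen⟩ := hex.choose_spec
  set U := hex.choose
  -- Quantifying over `G` allows the equality of operators to be substituted although the domain
  -- proof depends on it.
  have key : ∀ (G : E →ₗ.[ℂ] E), G = (B : E →ₗ[ℂ] E).toPMap ⊤ →
      ∃ hm : ψ ∈ G.domain, G ⟨ψ, hm⟩ = (c : ℂ) • ψ := by
    rintro _ rfl
    exact ⟨trivial, h⟩
  obtain ⟨hm, hG⟩ := key _ hgen
  exact hU.apply_eigenvector ⟨ψ, hm⟩ c hG t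

theorem expI_idOp_apply (t : ℝ) (ψ : E) :
    (expI (idOp : E →ₗ.[ℂ] E) t : E →L[ℂ] E) ψ = Complex.exp (Complex.I * t) • ψ := by
  have := expI_apply_eigenvector (ContinuousLinearMap.id ℂ E) (.one _) (ψ := ψ) (c := 1) (by simp) t
  simpa [idOp] using this

/-- If `B` exchanges `φ` and `χ`, a quarter period of `exp (i t B)` maps `φ` to `i χ`. -/
theorem expI_half_pi_apply (B : E →L[ℂ] E) (hB : IsSelfAdjoint B) {φ χ : E}
    (h₁ : B φ = χ) (h₂ : B χ = φ) :
    (expI ((B : E →ₗ[ℂ] E).toPMap ⊤) (Real.pi / 2) : E →L[ℂ] E) φ = Complex.I • χ := by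
  have hp := expI_apply_eigenvector B hB (ψ := φ + χ) (c := 1)
    (by simp [h₁, h₂, add_comm]) (Real.pi / 2)
  have hm := expI_apply_eigenvector B hB (ψ := φ - χ) (c := -1)
    (by simp [h₁, h₂]) (Real.pi / 2)
  have e1 : Complex.exp (Complex.I * (1 : ℝ) * (Real.pi / 2 : ℝ)) = Complex.I := by
    conv_rhs => rw [← Complex.exp_pi_div_two_mul_I]
    congr 1; push_cast; ring
  have e2 : Complex.exp (Complex.I * (-1 : ℝ) * (Real.pi / 2 : ℝ)) = -Complex.I := by
    conv_rhs => rw [← Complex.exp_neg_pi_div_two_mul_I]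
    congr 1; push_cast; ring
  rw [e1] at hp
  rw [e2] at hm
  have : φ = (1 / 2 : ℂ) • ((φ + χ) + (φ - χ)) := by module
  conv_lhs => rw [this]
  rw [map_smul, map_add, hp, hm]
  module

/-! ### The sectors of a representation of the circle -/

section Sectors

variable {π : Circle →* unitary (E →L[ℂ] E)}

theorem isUnitaryGroup_circle (hπ : StronglyContinuous π) :
    IsUnitaryGroup fun α : ℝ => π (Circle.exp α) where
  map_zero := by simp
  map_add s t := by simp [Circle.exp_add]
  strongCont ψ := (hπ ψ).comp Circle.exp.continuous

theorem mem_sector_iff (hπ : StronglyContinuous π) {μ : ℤ} {ψ : E} :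
    ψ ∈ sector π μ ↔
      ∀ α : ℝ, (π (Circle.exp α) : E →L[ℂ] E) ψ = Complex.exp (Complex.I * μ * α) • ψ := by
  have hmem : ψ ∈ sector π μ ↔ (ψ, (μ : ℂ) • ψ) ∈ (charge π).graph := Iff.rfl
  rw [hmem, LinearPMap.mem_graph_iff]
  constructor
  · rintro ⟨⟨χ, hχ⟩, rfl, h⟩ α
    have := (isUnitaryGroup_circle hπ).apply_eigenvector ⟨χ, hχ⟩ (μ : ℝ)
      (by simpa using (show generator (fun α : ℝ => π (Circle.exp α)) ⟨χ, hχ⟩ = _ from h)) α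
    simpa using this
  · intro h
    have hd : HasDerivAt (fun α : ℝ => (π (Circle.exp α) : E →L[ℂ] E) ψ)
        ((Complex.I * μ) • ψ) 0 := by
      simp only [h]
      have h2 : HasDerivAt (fun s : ℝ => Complex.exp (Complex.I * μ * s))
          (Complex.exp (Complex.I * μ * (0 : ℝ)) * (Complex.I * μ * 1)) 0 :=
        ((Complex.ofRealCLM.hasDerivAt (x := 0)).const_mul (Complex.I * μ)).cexp
      simpa using h2.smul_const ψ
    refine ⟨⟨ψ, hd.differentiableAt⟩, rfl, ?_⟩
    change -Complex.I • deriv (fun α : ℝ => (π (Circle.exp α) : E →L[ℂ] E) ψ) 0 = _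
    rw [hd.deriv, smul_smul, ← mul_assoc]
    simp

theorem inner_sector_eq_zero (hπ : StronglyContinuous π) {μ ν : ℤ} (hμν : μ ≠ ν) {φ ψ : E}
    (hφ : φ ∈ sector π μ) (hψ : ψ ∈ sector π ν) : inner ℂ φ ψ = 0 := by
  have hne : ((ν : ℂ) - μ) ≠ 0 := sub_ne_zero.2 (by exact_mod_cast hμν.symm)
  -- For this angle the relative phase of the two sectors is `-1`, so the inner product equals its
  -- own negative.
  set α : ℝ := Real.pi / (ν - μ) with hα
  have h := LinearIsometryEquiv.inner_map_map
    (Unitary.linearIsometryEquiv (π (Circle.exp α))) φ ψ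
  have h' : inner ℂ ((π (Circle.exp α) : E →L[ℂ] E) φ) ((π (Circle.exp α) : E →L[ℂ] E) ψ) =
    inner ℂ φ ψ := h
  rw [(mem_sector_iff hπ).1 hφ, (mem_sector_iff hπ).1 hψ, inner_smul_left, inner_smul_right,
    ← Complex.exp_conj, ← mul_assoc, ← Complex.exp_add] at h'
  have e : (starRingEnd ℂ) (Complex.I * μ * α) + Complex.I * ν * α = Real.pi * Complex.I := by
    simp only [map_mul, Complex.conj_I, Complex.conj_ofReal, map_intCast, hα]
    push_cast
    field_simp
    ring
  rw [e, Complex.exp_pi_mul_I] at h'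
  linear_combination (-1 / 2 : ℂ) * h'

theorem isOrtho_sector (hπ : StronglyContinuous π) {μ ν : ℤ} (hμν : μ ≠ ν) :
    sector π μ ⟂ sector π ν :=
  Submodule.isOrtho_iff_inner_eq.2 fun _ hφ _ hψ => inner_sector_eq_zero hπ hμν hφ hψ

open MeasureTheory AddCircle in
/-- The sectors are total: Fourier analysis on the circle. -/
theorem eq_zero_of_forall_inner_sector_eq_zero (hπ : StronglyContinuous π) {ψ : E}
    (h : ∀ μ, ∀ φ ∈ sector π μ, inner ℂ ψ φ = 0) : ψ = 0 := by
  have : Fact (0 < 2 * Real.pi) := ⟨Real.two_pi_pos⟩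
  let f : AddCircle (2 * Real.pi) → E := fun x => (π (toCircle x) : E →L[ℂ] E) ψ
  have hf : Continuous f := (hπ ψ).comp continuous_toCircle
  have hint : ∀ n : ℤ, Integrable (fun x => fourier (-n) x • f x) haarAddCircle := fun n =>
    ((fourier (-n)).continuous.smul hf).integrable_of_hasCompactSupport (.of_compactSpace _)
  -- The Fourier coefficients of the orbit of `ψ` lie in the sectors: translation invariance of Haar
  -- measure turns the action of the circle into the character.
  have hcoeff : ∀ n : ℤ, fourierCoeff f n ∈ sector π n := by
    intro n
    rw [mem_sector_iff hπ]
    intro α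
    unfold fourierCoeff
    rw [← ContinuousLinearMap.integral_comp_comm _ (hint n), ← integral_smul,
      ← integral_add_right_eq_self (μ := haarAddCircle)
        (fun x => Complex.exp (Complex.I * n * α) • fourier (-n) x • f x)
        (α : AddCircle (2 * Real.pi))]
    congr 1
    ext x
    have h1 : toCircle (α : AddCircle (2 * Real.pi)) = Circle.exp α := by
      rw [toCircle_apply_mk, div_self Real.two_pi_pos.ne', one_mul]
    have h2 : f (x + (α : AddCircle (2 * Real.pi))) = (π (Circle.exp α) : E →L[ℂ] E) (f x) := by
      simp only [f]
      rw [add_comm, toCircle_add, h1, map_mul]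
      rfl
    have h3 : fourier (-n) (x + (α : AddCircle (2 * Real.pi))) =
        fourier (-n) x * Complex.exp (-(Complex.I * n * α)) := by
      have h4 : fourier (-n) (α : AddCircle (2 * Real.pi)) =
          Complex.exp (-(Complex.I * n * α)) := by
        rw [fourier_coe_apply]
        congr 1
        have := Complex.ofReal_ne_zero.2 Real.pi_ne_zero
        push_cast
        field_simp
      rw [← h4]
      simp only [fourier_apply, smul_add, toCircle_add, Circle.coe_mul]
    rw [h2, h3, map_smul, smul_smul, mul_left_comm, ← Complex.exp_add, add_neg_cancel,
      Complex.exp_zero, mul_one]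
  -- All Fourier coefficients of this matrix element vanish, so its Fourier series converges to it
  -- pointwise and `g 0`, which is `⟨ψ, ψ⟩`, is zero.
  let g : C(AddCircle (2 * Real.pi), ℂ) := ⟨fun x => inner ℂ ψ (f x), by fun_prop⟩
  have hg : fourierCoeff g = 0 := by
    ext n
    have h1 := h n _ (hcoeff n)
    unfold fourierCoeff at h1 ⊢
    rw [← integral_inner (hint n)] at h1
    simpa [g, inner_smul_right] using h1
  have hs := has_pointwise_sum_fourier_series_of_summable (f := g) (by rw [hg]; exact summable_zero) 0
  rw [hg] at hs
  have h0 : g 0 = 0 := hs.unique (by simp)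
  simpa [g, f] using h0

end Sectors

/-! ### Sector projections and finite particle vectors -/

section Projections

variable {π : Circle →* unitary (E →L[ℂ] E)} [∀ μ, FiniteDimensional ℂ (sector π μ)]

theorem sectorProj_mem (μ : ℤ) (ψ : E) : sectorProj π μ ψ ∈ sector π μ :=
  Submodule.starProjection_apply_mem _ _

theorem sectorProj_eq_self {μ : ℤ} {ψ : E} (h : ψ ∈ sector π μ) : sectorProj π μ ψ = ψ :=
  Submodule.starProjection_eq_self_iff.2 h

theorem sectorProj_eq_zero (hπ : StronglyContinuous π) {μ ν : ℤ} (hμν : μ ≠ ν) {ψ : E}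
    (h : ψ ∈ sector π ν) : sectorProj π μ ψ = 0 :=
  (Submodule.starProjection_apply_eq_zero_iff _).2 ((isOrtho_sector hπ hμν.symm) h)

theorem inner_sectorProj (μ : ℤ) (φ ψ : E) :
    inner ℂ (sectorProj π μ φ) ψ = inner ℂ φ (sectorProj π μ ψ) :=
  Submodule.inner_starProjection_left_eq_right _ _ _

theorem sectorProj_eq_zero_of_neg (hpos : ∀ μ : ℤ, μ < 0 → sector π μ = ⊥) {μ : ℤ} (hμ : μ < 0)
    (ψ : E) : sectorProj π μ ψ = 0 := by
  have := sectorProj_mem (π := π) μ ψ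
  rwa [hpos μ hμ, Submodule.mem_bot] at this

theorem eq_of_forall_sectorProj_eq (hπ : StronglyContinuous π) {φ ψ : E}
    (h : ∀ μ, sectorProj π μ φ = sectorProj π μ ψ) : φ = ψ := by
  rw [← sub_eq_zero]
  refine eq_zero_of_forall_inner_sector_eq_zero hπ fun μ χ hχ => ?_
  rw [← sectorProj_eq_self hχ, ← inner_sectorProj, map_sub, h, sub_self, inner_zero_left]

theorem sectorProj_sum (hπ : StronglyContinuous π) (s : Finset ℤ) (f : ℤ → E)
    (hf : ∀ ν ∈ s, f ν ∈ sector π ν) (μ : ℤ) :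
    sectorProj π μ (∑ ν ∈ s, f ν) = if μ ∈ s then f μ else 0 := by
  rw [map_sum]
  have : ∀ ν ∈ s, sectorProj π μ (f ν) = if μ = ν then f μ else 0 := by
    intro ν hν
    split_ifs with h
    · subst h; exact sectorProj_eq_self (hf _ hν)
    · exact sectorProj_eq_zero hπ h (hf ν hν)
  rw [Finset.sum_congr rfl this, Finset.sum_ite_eq]

theorem eq_sum_sectorProj (hπ : StronglyContinuous π) {s : Finset ℤ} {ψ : E}
    (h : ∀ μ ∉ s, sectorProj π μ ψ = 0) : ψ = ∑ μ ∈ s, sectorProj π μ ψ := by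
  refine eq_of_forall_sectorProj_eq hπ fun μ => ?_
  rw [sectorProj_sum hπ s _ fun ν _ => sectorProj_mem ν ψ]
  split_ifs with hμ
  · rfl
  · exact h μ hμ

variable (π) in
/-- The finite particle vectors, as a subspace. -/
def finiteParticle : Submodule ℂ E where
  carrier := {ψ | IsFiniteParticle π ψ}
  add_mem' {a b} ha hb := (Set.Finite.union ha hb).subset fun μ hμ => by
    by_contra hc
    simp only [Set.mem_union, Set.mem_ofPred_eq, not_or, not_not] at hc
    exact hμ (by rw [map_add, hc.1, hc.2, add_zero])
  zero_mem' := by simp [IsFiniteParticle]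
  smul_mem' c a ha := Set.Finite.subset ha fun μ hμ hc => hμ (by rw [map_smul, hc, smul_zero])

theorem sector_le_finiteParticle (hπ : StronglyContinuous π) (μ : ℤ) :
    sector π μ ≤ finiteParticle π := fun ψ hψ =>
  (Set.finite_singleton μ).subset fun ν hν => by
    by_contra h
    exact hν (sectorProj_eq_zero hπ h hψ)

theorem dense_finiteParticle (hπ : StronglyContinuous π) :
    Dense (finiteParticle π : Set E) := by
  rw [Submodule.dense_iff_topologicalClosure_eq_top, Submodule.topologicalClosure_eq_top_iff,
    Submodule.eq_bot_iff]
  intro ψ hψ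
  exact eq_zero_of_forall_inner_sector_eq_zero hπ fun μ φ hφ =>
    Submodule.inner_left_of_mem_orthogonal (sector_le_finiteParticle hπ μ hφ) hψ

theorem exists_forall_sectorProj_eq_zero {ψ : E} (h : IsFiniteParticle π ψ) :
    ∃ N : ℕ, ∀ μ : ℤ, (N : ℤ) < μ → sectorProj π μ ψ = 0 := by
  obtain ⟨b, hb⟩ := Set.Finite.bddAbove h
  refine ⟨b.toNat, fun μ hμ => ?_⟩
  by_contra hc
  have := hb hc
  omega

end Projections

/-! ### Rotations within a sector by special unitaries -/

section

/-- The unitary reflection in the hyperplane orthogonal to `a`. -/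
def hyperplaneReflection (a : E) : unitary (E →L[ℂ] E) :=
  Unitary.linearIsometryEquiv.symm (ℂ ∙ a)ᗮ.reflection

theorem reflection_orthogonal_singleton_apply {F : Type*} [NormedAddCommGroup F]
    [InnerProductSpace ℂ F] (a ψ : F) :
    (ℂ ∙ a)ᗮ.reflection ψ = ψ - (2 * (inner ℂ a ψ / ((‖a‖ : ℂ) ^ 2))) • a := by
  rw [Submodule.reflection_orthogonal_apply, Submodule.reflection_singleton_apply]
  simp only [Complex.coe_algebraMap]
  module

theorem hyperplaneReflection_apply (a ψ : E) :
    (hyperplaneReflection a : E →L[ℂ] E) ψ =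
      ψ - (2 * (inner ℂ a ψ / ((‖a‖ : ℂ) ^ 2))) • a :=
  reflection_orthogonal_singleton_apply a ψ

theorem hyperplaneReflection_self (a : E) : (hyperplaneReflection a : E →L[ℂ] E) a = -a :=
  Submodule.reflection_orthogonalComplement_singleton_eq_neg a

/-- Equal norms alone do not suffice over `ℂ`: the symmetry of the inner product is what makes `x +
y` orthogonal to `x - y`. -/
theorem hyperplaneReflection_sub {x y : E} (hn : ‖x‖ = ‖y‖) (hi : inner ℂ x y = inner ℂ y x)
    (hne : x ≠ y) : (hyperplaneReflection (x - y) : E →L[ℂ] E) x = y := by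
  have h0 : ((‖x - y‖ : ℂ) ^ 2) ≠ 0 :=
    pow_ne_zero _ (Complex.ofReal_ne_zero.2 (norm_ne_zero_iff.2 (sub_ne_zero.2 hne)))
  have h1 : (2 * (inner ℂ (x - y) x / ((‖x - y‖ : ℂ) ^ 2))) = 1 := by
    rw [mul_div_assoc', div_eq_one_iff_eq h0]
    have h2 : ((‖x - y‖ : ℂ) ^ 2) = inner ℂ (x - y) (x - y) :=
      (inner_self_eq_norm_sq_to_K (𝕜 := ℂ) (x - y)).symm
    have h3 : inner ℂ x x = inner ℂ y y := by
      rw [inner_self_eq_norm_sq_to_K, inner_self_eq_norm_sq_to_K, hn]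
    rw [h2, inner_sub_left, inner_sub_left, inner_sub_right, inner_sub_right, hi, h3]
    ring
  rw [hyperplaneReflection_apply, h1, one_smul, sub_sub_cancel]

variable {π : Circle →* unitary (E →L[ℂ] E)}

theorem commute_hyperplaneReflection (hπ : StronglyContinuous π) {μ : ℤ} {a : E}
    (ha : a ∈ sector π μ) (z : Circle) : Commute (hyperplaneReflection a) (π z) := by
  obtain ⟨α, rfl⟩ : ∃ α : ℝ, Circle.exp α = z := ⟨_, Circle.exp_arg z⟩
  have hpa := (mem_sector_iff hπ).1 ha α
  set e := Complex.exp (Complex.I * μ * α)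
  have he : e * (starRingEnd ℂ) e = 1 := by
    rw [← Complex.exp_conj, ← Complex.exp_add]
    simp
  refine Subtype.ext (ContinuousLinearMap.ext fun ψ => ?_)
  change (hyperplaneReflection a : E →L[ℂ] E) ((π (Circle.exp α) : E →L[ℂ] E) ψ) =
    (π (Circle.exp α) : E →L[ℂ] E) ((hyperplaneReflection a : E →L[ℂ] E) ψ)
  have hi : inner ℂ ((π (Circle.exp α) : E →L[ℂ] E) a) ((π (Circle.exp α) : E →L[ℂ] E) ψ) =
      inner ℂ a ψ :=
    (Unitary.linearIsometryEquiv (π (Circle.exp α))).inner_map_map a ψ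
  rw [hpa, inner_smul_left] at hi
  have hi' : inner ℂ a ((π (Circle.exp α) : E →L[ℂ] E) ψ) = e * inner ℂ a ψ := by
    rw [← hi, ← mul_assoc, he, one_mul]
  rw [hyperplaneReflection_apply, hyperplaneReflection_apply, map_sub, map_smul, hpa, hi',
    smul_smul]
  congr 2
  ring

theorem hyperplaneReflection_mem_sector (hπ : StronglyContinuous π) {μ ν : ℤ} {a x : E}
    (ha : a ∈ sector π μ) (hx : x ∈ sector π ν) :
    (hyperplaneReflection a : E →L[ℂ] E) x ∈ sector π ν := by
  rw [hyperplaneReflection_apply]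
  by_cases h : μ = ν
  · subst h
    exact sub_mem hx (Submodule.smul_mem _ _ ha)
  · simpa [inner_sector_eq_zero hπ h ha hx] using hx

variable [∀ μ, FiniteDimensional ℂ (sector π μ)]

theorem sectorProj_hyperplaneReflection {μ : ℤ} {a : E} (ha : a ∈ sector π μ) (ψ : E) :
    sectorProj π μ ((hyperplaneReflection a : E →L[ℂ] E) ψ) =
      (hyperplaneReflection a : E →L[ℂ] E) (sectorProj π μ ψ) := by
  rw [hyperplaneReflection_apply, hyperplaneReflection_apply, map_sub, map_smul,
    ← inner_sectorProj, sectorProj_eq_self ha]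

theorem sectorProj_hyperplaneReflection_of_ne (hπ : StronglyContinuous π) {μ ν : ℤ} (hμν : ν ≠ μ)
    {a : E} (ha : a ∈ sector π μ) (ψ : E) :
    sectorProj π ν ((hyperplaneReflection a : E →L[ℂ] E) ψ) = sectorProj π ν ψ := by
  rw [hyperplaneReflection_apply, map_sub, map_smul, sectorProj_eq_zero hπ hμν ha, smul_zero,
    sub_zero]

theorem coe_block_apply (U : unitary (E →L[ℂ] E)) (μ : ℤ) (x : sector π μ) :
    (block π U μ x : E) = sectorProj π μ ((U : E →L[ℂ] E) x) := rfl

theorem block_mul (U V : unitary (E →L[ℂ] E)) {μ : ℤ}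
    (hV : ∀ x ∈ sector π μ, (V : E →L[ℂ] E) x ∈ sector π μ) :
    block π (U * V) μ = block π U μ * block π V μ := by
  refine LinearMap.ext fun x => Subtype.ext ?_
  rw [Module.End.mul_apply, coe_block_apply, coe_block_apply, coe_block_apply,
    sectorProj_eq_self (hV x x.2)]
  rfl

theorem det_block_hyperplaneReflection (hπ : StronglyContinuous π) {μ : ℤ} {a : E}
    (ha : a ∈ sector π μ) (ha0 : a ≠ 0) (ν : ℤ) :
    LinearMap.det (block π (hyperplaneReflection a) ν) = if μ = ν then -1 else 1 := by
  split_ifs with h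
  · subst h
    set a' : sector π μ := ⟨a, ha⟩
    have hb : block π (hyperplaneReflection a) μ =
        ((ℂ ∙ a')ᗮ.reflection.toLinearMap : sector π μ →ₗ[ℂ] sector π μ) := by
      refine LinearMap.ext fun x => Subtype.ext ?_
      rw [coe_block_apply, sectorProj_eq_self (hyperplaneReflection_mem_sector hπ ha x.2),
        hyperplaneReflection_apply]
      exact (congrArg Subtype.val (reflection_orthogonal_singleton_apply a' x)).symm
    have ha' : a' ≠ 0 := fun hc => ha0 (congrArg Subtype.val hc)
    rw [hb, Submodule.det_reflection, Submodule.orthogonal_orthogonal,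
      finrank_span_singleton ha', pow_one]
  · have hb : block π (hyperplaneReflection a) ν = LinearMap.id := by
      refine LinearMap.ext fun x => Subtype.ext ?_
      rw [coe_block_apply, hyperplaneReflection_apply, inner_sector_eq_zero hπ h ha x.2]
      simpa using sectorProj_eq_self x.2
    rw [hb, LinearMap.det_id]

/-- Each reflection has determinant `-1` on the sector `μ` and `1` on the others, so the signs
cancel. -/
theorem hyperplaneReflection_mul_mem_specialUnitary (hπ : StronglyContinuous π) {μ : ℤ} {a b : E}
    (ha : a ∈ sector π μ) (ha0 : a ≠ 0) (hb : b ∈ sector π μ) (hb0 : b ≠ 0) :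
    hyperplaneReflection a * hyperplaneReflection b ∈ specialUnitary π := by
  refine ⟨fun z => (commute_hyperplaneReflection hπ ha z).mul_left
    (commute_hyperplaneReflection hπ hb z), fun ν => ?_⟩
  rw [block_mul _ _ fun x hx => hyperplaneReflection_mem_sector hπ hb hx, map_mul,
    det_block_hyperplaneReflection hπ ha ha0, det_block_hyperplaneReflection hπ hb hb0]
  split_ifs <;> simp

theorem one_mem_specialUnitary : (1 : unitary (E →L[ℂ] E)) ∈ specialUnitary π := by
  refine ⟨fun z => Commute.one_left _, fun μ => ?_⟩
  have : block π 1 μ = LinearMap.id :=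
    LinearMap.ext fun x => Subtype.ext (sectorProj_eq_self x.2)
  rw [this, LinearMap.det_id]

/-- The component of a vector in one sector can be turned into any given direction, without
touching the other components. -/
theorem exists_specialUnitary_rotation (hπ : StronglyContinuous π) {μ : ℤ} {y : E}
    (hy : y ∈ sector π μ) (hy0 : y ≠ 0) (ψ : E) :
    ∃ U ∈ specialUnitary π, (∃ c : ℂ, sectorProj π μ ((U : E →L[ℂ] E) ψ) = c • y) ∧
      ∀ ν ≠ μ, sectorProj π ν ((U : E →L[ℂ] E) ψ) = sectorProj π ν ψ := by
  set x := sectorProj π μ ψ with hx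
  have hxs : x ∈ sector π μ := sectorProj_mem μ ψ
  obtain ⟨θ, hθ, hθx⟩ := RCLike.exists_norm_eq_mul_self (inner ℂ x y)
  -- With this scalar `c • y` has the norm of `x` and a real inner product with `x`, so that one
  -- reflection carries `x` to `c • y`.
  set c : ℂ := (‖x‖ / ‖y‖ : ℝ) * θ with hc
  have hny : ‖y‖ ≠ 0 := norm_ne_zero_iff.2 hy0
  have hnorm : ‖x‖ = ‖c • y‖ := by
    rw [norm_smul, hc, norm_mul, hθ, mul_one, Complex.norm_real, Real.norm_eq_abs,
      abs_of_nonneg (by positivity), div_mul_cancel₀ _ hny]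
  by_cases hxy : x = c • y
  · exact ⟨1, one_mem_specialUnitary, ⟨c, hxy⟩, fun _ _ => rfl⟩
  have hcy : c • y ∈ sector π μ := Submodule.smul_mem _ _ hy
  have hsub : x - c • y ∈ sector π μ := sub_mem hxs hcy
  have hcy0 : c • y ≠ 0 := by
    intro h
    rw [h, norm_zero, norm_eq_zero] at hnorm
    exact hxy (hnorm.trans h.symm)
  have hreal : inner ℂ x (c • y) = inner ℂ (c • y) x := by
    have : inner ℂ x (c • y) = ((‖x‖ / ‖y‖ * ‖inner ℂ x y‖ : ℝ) : ℂ) := by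
      rw [inner_smul_right, hc, mul_assoc, ← hθx]
      push_cast
      rfl
    rw [← inner_conj_symm (c • y) x, this, Complex.conj_ofReal]
  -- The second reflection, along `c • y`, restores the determinant at the cost of a sign.
  refine ⟨_, hyperplaneReflection_mul_mem_specialUnitary hπ hcy hcy0 hsub (sub_ne_zero.2 hxy),
    ⟨-c, ?_⟩, fun ν hν => ?_⟩
  · change sectorProj π μ ((hyperplaneReflection (c • y) : E →L[ℂ] E)
      ((hyperplaneReflection (x - c • y) : E →L[ℂ] E) ψ)) = _
    rw [sectorProj_hyperplaneReflection hcy, sectorProj_hyperplaneReflection hsub, ← hx,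
      hyperplaneReflection_sub hnorm hreal hxy, hyperplaneReflection_self, neg_smul]
  · change sectorProj π ν ((hyperplaneReflection (c • y) : E →L[ℂ] E)
      ((hyperplaneReflection (x - c • y) : E →L[ℂ] E) ψ)) = _
    rw [sectorProj_hyperplaneReflection_of_ne hπ hν hcy,
      sectorProj_hyperplaneReflection_of_ne hπ hν hsub]

end

/-! ### Complementary operators are bounded -/

section

theorem inner_graph_comm {A : E →ₗ.[ℂ] E} (hA : IsSelfAdjoint A) {x y x' y' : E}
    (h : (x, y) ∈ A.graph) (h' : (x', y') ∈ A.graph) : inner ℂ y x' = inner ℂ x y' := by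
  rw [LinearPMap.mem_graph_iff] at h h'
  obtain ⟨a, rfl, rfl⟩ := h
  obtain ⟨b, rfl, rfl⟩ := h'
  have := LinearPMap.adjoint_isFormalAdjoint hA.dense_domain
  rw [LinearPMap.isSelfAdjoint_def.1 hA] at this
  exact this a b

/-- A selfadjoint operator that is bounded on a dense subspace of its domain is bounded and
everywhere defined. -/
theorem exists_eq_toPMap_of_bound {A : E →ₗ.[ℂ] E} (hA : IsSelfAdjoint A) {D : Submodule ℂ E}
    (hD : Dense (D : Set E)) (hDA : D ≤ A.domain) (C : ℝ)
    (hC : ∀ (ψ : E) (h : ψ ∈ D), ‖A ⟨ψ, hDA h⟩‖ ≤ C * ‖ψ‖) :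
    ∃ B : E →L[ℂ] E, IsSelfAdjoint B ∧ A = (B : E →ₗ[ℂ] E).toPMap ⊤ := by
  let T : D →L[ℂ] E := (A.toFun ∘ₗ Submodule.inclusion hDA).mkContinuous C fun ψ => hC ψ ψ.2
  have hdr : DenseRange D.subtypeL := by
    simpa [DenseRange] using hD
  let B : E →L[ℂ] E := T.extend D.subtypeL
  have hBT : ∀ (ψ : E) (h : ψ ∈ D), B ψ = A ⟨ψ, hDA h⟩ := fun ψ h =>
    ContinuousLinearMap.extend_eq T hdr isUniformEmbedding_subtype_val.isUniformInducing ⟨ψ, h⟩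
  -- Selfadjoint operators are closed, so the graph of the extension stays inside that of `A`; being
  -- everywhere defined, `B` then exhausts it.
  have hgraph : ∀ ψ, (ψ, B ψ) ∈ A.graph := by
    have hcl : IsClosed {ψ : E | (ψ, B ψ) ∈ A.graph} :=
      IsClosed.preimage (by fun_prop : Continuous fun ψ : E => (ψ, B ψ)) hA.isClosed
    intro ψ
    exact hcl.closure_subset_iff.2 (fun χ hχ => by
      change (χ, B χ) ∈ A.graph
      rw [hBT χ hχ]
      exact A.mem_graph ⟨χ, hDA hχ⟩) (hD ψ)
  refine ⟨B, ?_, ?_⟩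
  · rw [ContinuousLinearMap.isSelfAdjoint_iff_isSymmetric]
    exact fun x y => inner_graph_comm hA (hgraph x) (hgraph y)
  · refine LinearPMap.eq_of_eq_graph (Submodule.ext fun ⟨x, y⟩ => ?_)
    have : (x, y) ∈ ((B : E →ₗ[ℂ] E).toPMap ⊤).graph ↔ B x = y := by
      simp [LinearPMap.mem_graph_iff]
    rw [this]
    constructor
    · intro h
      exact A.mem_graph_snd_inj (hgraph x) h rfl
    · rintro rfl
      exact hgraph x

/-- The vectors `ψ` with `A (A ψ) = ψ`. -/
def involutive (A : E →ₗ.[ℂ] E) : Submodule ℂ E where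
  carrier := {ψ | ∃ χ, (ψ, χ) ∈ A.graph ∧ (χ, ψ) ∈ A.graph}
  add_mem' := by
    rintro a b ⟨a', ha, ha'⟩ ⟨b', hb, hb'⟩
    exact ⟨a' + b', A.graph.add_mem ha hb, A.graph.add_mem ha' hb'⟩
  zero_mem' := ⟨0, A.graph.zero_mem, A.graph.zero_mem⟩
  smul_mem' := by
    rintro c a ⟨a', ha, ha'⟩
    exact ⟨c • a', A.graph.smul_mem c ha, A.graph.smul_mem c ha'⟩

variable {π : Circle →* unitary (E →L[ℂ] E)} [∀ μ, FiniteDimensional ℂ (sector π μ)]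

namespace Splitting

variable (S : Splitting π)

theorem Xplus_mem (μ : ℤ) (ψ : E) : S.Xplus μ ψ ∈ sector π μ := sectorProj_mem _ _

theorem Xminus_mem (μ : ℤ) (ψ : E) : S.Xminus μ ψ ∈ sector π μ := sectorProj_mem _ _

theorem Xplus_apply (μ : ℤ) (ψ : E) : S.Xplus μ ψ = S.plus (sectorProj π μ ψ) :=
  (DFunLike.congr_fun (S.plus_comm μ).eq ψ).symm

theorem Xminus_apply (μ : ℤ) (ψ : E) : S.Xminus μ ψ = S.minus (sectorProj π μ ψ) :=
  (DFunLike.congr_fun (S.minus_comm μ).eq ψ).symm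

theorem Xplus_of_mem {μ : ℤ} {ψ : E} (h : ψ ∈ sector π μ) : S.Xplus μ ψ = S.plus ψ := by
  rw [Xplus_apply, sectorProj_eq_self h]

theorem Xminus_of_mem {μ : ℤ} {ψ : E} (h : ψ ∈ sector π μ) : S.Xminus μ ψ = S.minus ψ := by
  rw [Xminus_apply, sectorProj_eq_self h]

theorem Xplus_of_mem_of_ne (hπ : StronglyContinuous π) {μ ν : ℤ} (hμν : μ ≠ ν) {ψ : E}
    (h : ψ ∈ sector π ν) : S.Xplus μ ψ = 0 := by
  rw [Xplus_apply, sectorProj_eq_zero hπ hμν h, map_zero]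

theorem plus_plus (ψ : E) : S.plus (S.plus ψ) = S.plus ψ :=
  DFunLike.congr_fun S.plus_proj.isIdempotentElem ψ

theorem minus_minus (ψ : E) : S.minus (S.minus ψ) = S.minus ψ :=
  DFunLike.congr_fun S.minus_proj.isIdempotentElem ψ

theorem Xplus_Xplus (μ : ℤ) (ψ : E) : S.Xplus μ (S.Xplus μ ψ) = S.Xplus μ ψ := by
  rw [S.Xplus_of_mem (S.Xplus_mem μ ψ), S.Xplus_apply, S.plus_plus]

theorem Xminus_Xminus (μ : ℤ) (ψ : E) : S.Xminus μ (S.Xminus μ ψ) = S.Xminus μ ψ := by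
  rw [S.Xminus_of_mem (S.Xminus_mem μ ψ), S.Xminus_apply, S.minus_minus]

theorem inner_Xminus (μ : ℤ) (φ ψ : E) :
    inner ℂ (S.Xminus μ φ) ψ = inner ℂ φ (S.Xminus μ ψ) := by
  have hm : ∀ x y, inner ℂ (S.minus x) y = inner ℂ x (S.minus y) :=
    ContinuousLinearMap.isSelfAdjoint_iff_isSymmetric.1 S.minus_proj.isSelfAdjoint
  rw [Xminus_apply, hm, inner_sectorProj]
  rfl

theorem minus_add_zero_add_plus (ψ : E) : S.minus ψ + S.zero ψ + S.plus ψ = ψ :=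
  DFunLike.congr_fun S.sum_eq_one ψ

theorem minus_of_mem_sector_zero {ψ : E} (h : ψ ∈ sector π 0) : S.minus ψ = ψ := by
  have := DFunLike.congr_fun S.minus_sector_zero ψ
  change S.Xminus 0 ψ = _ at this
  rwa [S.Xminus_of_mem h, sectorProj_eq_self h] at this

theorem zero_minus (ψ : E) : S.zero (S.minus ψ) = 0 := by
  have h := congrArg star S.minus_mul_zero
  rw [star_mul, S.minus_proj.isSelfAdjoint.star_eq, S.zero_proj.isSelfAdjoint.star_eq,
    star_zero] at h
  exact DFunLike.congr_fun h ψ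

theorem zero_zero (ψ : E) : S.zero (S.zero ψ) = S.zero ψ :=
  DFunLike.congr_fun S.zero_proj.isIdempotentElem ψ

theorem F_apply (ψ : E) : S.F ψ = sectorProj π 0 ψ + S.Xplus 1 ψ := rfl

variable {S} {A : E →ₗ.[ℂ] E}

namespace IsCompl

/-- On the range of `X₊^(μ+1)` the operator acts as a partial isometry, and it undoes this
on the range of `X₋^(μ)`. -/
theorem exists_partialIsometry (hS : S.IsCompl A) (hA : IsSelfAdjoint A)
    (hπ : StronglyContinuous π) {μ : ℤ} (hμ : 1 ≤ μ) :
    ∃ V : E →L[ℂ] E, V * star V = S.Xminus μ ∧ ∀ ψ, V ψ ∈ sector π μ ∧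
      (S.Xplus (μ + 1) ψ, V ψ) ∈ A.graph ∧ (V ψ, S.Xplus (μ + 1) ψ) ∈ A.graph := by
  obtain ⟨V, hV, hVV, hVV'⟩ := hS.partialIsometry μ hμ
  have hmem : ∀ ψ, V ψ ∈ sector π μ := fun ψ => by
    obtain ⟨h, e⟩ := hV ψ
    rw [e]; exact S.Xminus_mem _ _
  have hfix : ∀ ψ, S.Xminus μ (V ψ) = V ψ := fun ψ => by
    obtain ⟨h, e⟩ := hV ψ
    rw [e, S.Xminus_Xminus]
  have hgraph : ∀ ψ, (S.Xplus (μ + 1) ψ, V ψ) ∈ A.graph := fun ψ => by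
    obtain ⟨h, e⟩ := hV ψ
    -- Intertwining applied to `X₊^(μ+1) ψ` itself shows that `A` maps this vector to `V ψ` exactly,
    -- not merely after projection by `X₋^(μ)`.
    obtain ⟨h', e'⟩ := hS.intertwine μ hμ ⟨_, h⟩
      (sector_le_finiteParticle hπ _ (S.Xplus_mem (μ + 1) ψ))
    rw [e, ← e', LinearPMap.mem_graph_iff]
    exact ⟨⟨_, h'⟩, S.Xplus_Xplus _ _, rfl⟩
  refine ⟨V, hVV', fun ψ => ⟨hmem ψ, hgraph ψ, ?_⟩⟩
  have hd : V ψ ∈ A.domain := hS.finiteParticle_mem _ (sector_le_finiteParticle hπ _ (hmem ψ))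
  suffices h : A ⟨V ψ, hd⟩ = S.Xplus (μ + 1) ψ by
    rw [← h]; exact A.mem_graph ⟨V ψ, hd⟩
  -- Against finite particle `φ`: `⟨φ, A V ψ⟩ = ⟨X₋ A φ, V ψ⟩ = ⟨V φ, V ψ⟩ = ⟨φ, X₊ ψ⟩`.
  refine (dense_finiteParticle hπ).eq_of_inner_right (𝕜 := ℂ) fun φ hφ => ?_
  have hφd := hS.finiteParticle_mem φ hφ
  obtain ⟨h', e'⟩ := hS.intertwine μ hμ ⟨φ, hφd⟩ hφ
  have e'' : S.Xminus μ (A ⟨φ, hφd⟩) = V φ := by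
    rw [← e']
    exact A.mem_graph_snd_inj (A.mem_graph ⟨_, h'⟩) (hgraph φ) rfl
  rw [← inner_graph_comm hA (A.mem_graph ⟨φ, hφd⟩) (A.mem_graph ⟨V ψ, hd⟩), ← hVV]
  change inner ℂ (A ⟨φ, hφd⟩) (V ψ) = inner ℂ φ (ContinuousLinearMap.adjoint V (V ψ))
  rw [ContinuousLinearMap.adjoint_inner_right, ← e'', S.inner_Xminus, hfix]

/-- Outside `F` and `E₀` there remain `X₋^(1)` in charge 1 and `X₋^(μ) + X₊^(μ)` in charge `μ ≥ 2`.
Each of these is the source or target of one of the partial isometries; charge 0 lies wholly in `F`.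
-/
theorem remainder_mem_involutive (hS : S.IsCompl A) (hA : IsSelfAdjoint A)
    (hπ : StronglyContinuous π) (hpos : ∀ μ : ℤ, μ < 0 → sector π μ = ⊥) {ψ : E}
    (hψ : IsFiniteParticle π ψ) : (1 - S.F - S.zero) ψ ∈ involutive A := by
  have hplus : ∀ μ : ℤ, 1 ≤ μ → ∀ φ, S.Xplus (μ + 1) φ ∈ involutive A := fun μ hμ φ => by
    obtain ⟨V, -, hV⟩ := hS.exists_partialIsometry hA hπ hμ
    exact ⟨V φ, (hV φ).2⟩
  have hminus : ∀ μ : ℤ, 1 ≤ μ → ∀ φ, S.Xminus μ φ ∈ involutive A := fun μ hμ φ => by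
    obtain ⟨V, hVV, hV⟩ := hS.exists_partialIsometry hA hπ hμ
    rw [← hVV]
    exact ⟨_, (hV (star V φ)).2.symm⟩
  have hsec : ∀ (μ : ℤ) (φ : E), φ ∈ sector π μ → (1 - S.F - S.zero) φ ∈ involutive A := by
    intro μ φ hφ
    change φ - S.F φ - S.zero φ ∈ _
    have hsum := S.minus_add_zero_add_plus φ
    rw [S.F_apply]
    rcases lt_trichotomy μ 0 with hμ | rfl | hμ
    · rw [hpos μ hμ, Submodule.mem_bot] at hφ
      simp [hφ]
    · rw [S.Xplus_of_mem_of_ne hπ (by norm_num) hφ, sectorProj_eq_self hφ,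
        ← S.minus_of_mem_sector_zero hφ, S.zero_minus]
      simp
    · rw [sectorProj_eq_zero hπ hμ.ne hφ, zero_add]
      obtain rfl | hμ1 := eq_or_ne μ 1
      · have : φ - S.Xplus 1 φ - S.zero φ = S.Xminus 1 φ := by
          rw [S.Xplus_of_mem hφ, S.Xminus_of_mem hφ]
          nth_rewrite 1 [← hsum]
          abel
        rw [this]
        exact hminus 1 le_rfl φ
      · have : φ - S.Xplus 1 φ - S.zero φ = S.Xminus μ φ + S.Xplus (μ - 1 + 1) φ := by
          rw [S.Xplus_of_mem_of_ne hπ hμ1.symm hφ, sub_add_cancel, S.Xplus_of_mem hφ,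
            S.Xminus_of_mem hφ]
          nth_rewrite 1 [← hsum]
          abel
        rw [this]
        -- `X₊^(μ)` is the source of the partial isometry with index `μ - 1`, which requires `μ ≥
        -- 2`.
        exact add_mem (hminus μ (by omega) φ) (hplus (μ - 1) (by omega) φ)
  rw [eq_sum_sectorProj hπ (s := hψ.toFinset) (ψ := ψ) (fun μ hμ => by
    by_contra h
    exact hμ (hψ.mem_toFinset.2 h)), map_sum]
  exact Submodule.sum_mem _ fun μ _ => hsec μ _ (sectorProj_mem μ ψ)

theorem exists_bound (hS : S.IsCompl A) (hA : IsSelfAdjoint A) (hπ : StronglyContinuous π)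
    (hpos : ∀ μ : ℤ, μ < 0 → sector π μ = ⊥) :
    ∃ C : ℝ, ∀ ψ (h : ψ ∈ A.domain), IsFiniteParticle π ψ → ‖A ⟨ψ, h⟩‖ ≤ C * ‖ψ‖ := by
  have hK : sector π 0 ⊔ sector π 1 ≤ A.domain :=
    (sup_le (sector_le_finiteParticle hπ 0) (sector_le_finiteParticle hπ 1)).trans
      hS.finiteParticle_mem
  let T : ↥(sector π 0 ⊔ sector π 1) →L[ℂ] E :=
    LinearMap.toContinuousLinearMap (A.toFun ∘ₗ Submodule.inclusion hK)
  refine ⟨‖T‖ * ‖S.F‖ + ‖(1 - S.F - S.zero : E →L[ℂ] E)‖, fun ψ h hψ => ?_⟩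
  obtain ⟨χ, h₁, h₂⟩ := hS.remainder_mem_involutive hA hπ hpos hψ
  -- Symmetry makes `A` isometric where `A² = 1`: `⟨A x, A x⟩ = ⟨x, A A x⟩ = ⟨x, x⟩`.
  have hχ : ‖χ‖ = ‖(1 - S.F - S.zero : E →L[ℂ] E) ψ‖ := by
    have := inner_graph_comm hA h₁ h₂
    rw [inner_self_eq_norm_sq_to_K, inner_self_eq_norm_sq_to_K] at this
    have h' : ‖χ‖ ^ 2 = ‖(1 - S.F - S.zero : E →L[ℂ] E) ψ‖ ^ 2 := by exact_mod_cast this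
    exact (pow_left_inj₀ (norm_nonneg _) (norm_nonneg _) two_ne_zero).1 h'
  have hF : S.F ψ ∈ sector π 0 ⊔ sector π 1 := by
    rw [S.F_apply]
    exact Submodule.add_mem_sup (sectorProj_mem 0 ψ) (S.Xplus_mem 1 ψ)
  have hFg : (S.F ψ, T ⟨_, hF⟩) ∈ A.graph := A.mem_graph ⟨S.F ψ, hK hF⟩
  obtain ⟨hz, ez⟩ := hS.zero_on (S.zero ψ) (S.zero_zero ψ)
  have hzg : (S.zero ψ, 0) ∈ A.graph := by
    rw [← ez]; exact A.mem_graph ⟨S.zero ψ, hz⟩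
  have hsum := A.graph.add_mem (A.graph.add_mem hFg hzg) h₁
  have hA' : A ⟨ψ, h⟩ = T ⟨_, hF⟩ + 0 + χ := by
    refine A.mem_graph_snd_inj (A.mem_graph ⟨ψ, h⟩) hsum ?_
    change ψ = S.F ψ + S.zero ψ + (ψ - S.F ψ - S.zero ψ)
    abel
  rw [hA', add_zero, add_mul]
  refine (norm_add_le _ _).trans (add_le_add ?_ ?_)
  · refine (T.le_opNorm _).trans ?_
    rw [mul_assoc]
    exact mul_le_mul_of_nonneg_left (S.F.le_opNorm ψ) (norm_nonneg _)
  · rw [hχ]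
    exact ContinuousLinearMap.le_opNorm _ _

theorem exists_eq_toPMap (hS : S.IsCompl A) (hA : IsSelfAdjoint A) (hπ : StronglyContinuous π)
    (hpos : ∀ μ : ℤ, μ < 0 → sector π μ = ⊥) :
    ∃ B : E →L[ℂ] E, IsSelfAdjoint B ∧ A = (B : E →ₗ[ℂ] E).toPMap ⊤ := by
  obtain ⟨C, hC⟩ := hS.exists_bound hA hπ hpos
  exact exists_eq_toPMap_of_bound hA (dense_finiteParticle hπ) hS.finiteParticle_mem C
    fun ψ h => hC ψ _ h

/-- A quarter period of `exp (i t A)` lowers the charge on the range of `X₊^(μ+1)`. -/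
theorem expI_half_pi_Xplus_mem (hS : S.IsCompl A) (hA : IsSelfAdjoint A)
    (hπ : StronglyContinuous π) (hpos : ∀ μ : ℤ, μ < 0 → sector π μ = ⊥) {μ : ℤ} (hμ : 1 ≤ μ)
    (ψ : E) : (expI A (Real.pi / 2) : E →L[ℂ] E) (S.Xplus (μ + 1) ψ) ∈ sector π μ := by
  obtain ⟨V, -, hV⟩ := hS.exists_partialIsometry hA hπ hμ
  obtain ⟨hmem, h₁, h₂⟩ := hV ψ
  obtain ⟨B, hB, rfl⟩ := hS.exists_eq_toPMap hA hπ hpos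
  have hgraph : ∀ x y, (x, y) ∈ ((B : E →ₗ[ℂ] E).toPMap ⊤).graph → B x = y := by
    intro x y h
    simpa [LinearPMap.mem_graph_iff] using h
  rw [expI_half_pi_apply B hB (hgraph _ _ h₁) (hgraph _ _ h₂)]
  exact Submodule.smul_mem _ _ hmem

end IsCompl

end Splitting

end

/-! ### Steering finite particle vectors -/

section Steering

variable {π : Circle →* unitary (E →L[ℂ] E)} [∀ μ, FiniteDimensional ℂ (sector π μ)]

namespace Splitting

variable (S : Splitting π)

theorem sectorProj_F (hπ : StronglyContinuous π) (μ : ℤ) (ψ : E) :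
    sectorProj π μ (S.F ψ) =
      if μ = 0 then sectorProj π 0 ψ else if μ = 1 then S.Xplus 1 ψ else 0 := by
  rw [S.F_apply, map_add]
  split_ifs with h0 h1
  · subst h0
    rw [sectorProj_eq_self (sectorProj_mem 0 ψ),
      sectorProj_eq_zero hπ (by norm_num) (S.Xplus_mem 1 ψ), add_zero]
  · subst h1
    rw [sectorProj_eq_zero hπ (by norm_num) (sectorProj_mem 0 ψ),
      sectorProj_eq_self (S.Xplus_mem 1 ψ), zero_add]
  · rw [sectorProj_eq_zero hπ h0 (sectorProj_mem 0 ψ),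
      sectorProj_eq_zero hπ h1 (S.Xplus_mem 1 ψ), add_zero]

theorem F_F (hπ : StronglyContinuous π) (ψ : E) : S.F (S.F ψ) = S.F ψ := by
  rw [S.F_apply (S.F ψ), S.Xplus_apply, S.sectorProj_F hπ, S.sectorProj_F hπ, if_pos rfl,
    if_neg one_ne_zero, if_pos rfl, ← S.Xplus_of_mem (S.Xplus_mem 1 ψ), S.Xplus_Xplus,
    S.F_apply]

theorem exists_Xplus_ne_zero {μ : ℤ} (hμ : 1 ≤ μ) : ∃ ψ, S.Xplus μ ψ ≠ 0 := by
  by_contra! h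
  exact S.plus_ne_zero μ hμ (ContinuousLinearMap.ext h)

theorem exists_norm_eq_one_F_eq (hπ : StronglyContinuous π) : ∃ ψ : E, ‖ψ‖ = 1 ∧ S.F ψ = ψ := by
  obtain ⟨v, hv⟩ := S.exists_Xplus_ne_zero le_rfl
  refine ⟨((‖S.Xplus 1 v‖ : ℂ)⁻¹) • S.Xplus 1 v, ?_, ?_⟩
  · rw [norm_smul, norm_inv, Complex.norm_real, norm_norm, inv_mul_cancel₀ (norm_ne_zero_iff.2 hv)]
  · rw [map_smul, S.F_apply, S.Xplus_Xplus,
      sectorProj_eq_zero hπ (by norm_num) (S.Xplus_mem 1 v), zero_add]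

variable {G : Subgroup (unitary (E →L[ℂ] E))}

theorem exists_rotation (hπ : StronglyContinuous π) (hG : ∀ U ∈ specialUnitary π, U ∈ G)
    (ψ : E) (T : Finset ℤ) (hT : ∀ μ ∈ T, 1 ≤ μ) :
    ∃ U ∈ G, (∀ μ ∈ T, S.Xplus μ ((U : E →L[ℂ] E) ψ) = sectorProj π μ ((U : E →L[ℂ] E) ψ)) ∧
      ∀ ν ∉ T, sectorProj π ν ((U : E →L[ℂ] E) ψ) = sectorProj π ν ψ := by
  induction T using Finset.induction_on with
  | empty => exact ⟨1, G.one_mem, by simp, fun _ _ => rfl⟩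
  | insert μ T hμT ih =>
    obtain ⟨U, hU, h₁, h₂⟩ := ih fun ν hν => hT ν (Finset.mem_insert_of_mem hν)
    obtain ⟨v, hv⟩ := S.exists_Xplus_ne_zero (hT μ (Finset.mem_insert_self μ T))
    obtain ⟨W, hW, ⟨c, hc⟩, hW'⟩ :=
      exists_specialUnitary_rotation hπ (S.Xplus_mem μ v) hv ((U : E →L[ℂ] E) ψ)
    refine ⟨W * U, G.mul_mem (hG W hW) hU, fun ν hν => ?_, fun ν hν => ?_⟩
    · change S.Xplus ν ((W : E →L[ℂ] E) ((U : E →L[ℂ] E) ψ)) =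
        sectorProj π ν ((W : E →L[ℂ] E) ((U : E →L[ℂ] E) ψ))
      obtain rfl | hne := eq_or_ne ν μ
      · rw [S.Xplus_apply, hc, map_smul, ← S.Xplus_of_mem (S.Xplus_mem ν v), S.Xplus_Xplus]
      · rw [S.Xplus_apply, hW' ν hne, ← S.Xplus_apply,
          h₁ ν (Finset.mem_of_mem_insert_of_ne hν hne)]
    · change sectorProj π ν ((W : E →L[ℂ] E) ((U : E →L[ℂ] E) ψ)) = _
      rw [Finset.mem_insert, not_or] at hν
      rw [hW' ν hν.1, h₂ ν hν.2]

/-- Special unitaries can turn all components of a finite particle vector with positive charge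
into the range of `E₊`. -/
theorem exists_rotation_of_bounded (hπ : StronglyContinuous π)
    (hG : ∀ U ∈ specialUnitary π, U ∈ G) {ψ : E} {N : ℤ}
    (hψ : ∀ μ : ℤ, N < μ → sectorProj π μ ψ = 0) :
    ∃ U ∈ G,
      (∀ μ, 1 ≤ μ → S.Xplus μ ((U : E →L[ℂ] E) ψ) = sectorProj π μ ((U : E →L[ℂ] E) ψ)) ∧
      ∀ μ : ℤ, 1 ≤ μ → N < μ → sectorProj π μ ((U : E →L[ℂ] E) ψ) = 0 := by
  obtain ⟨U, hU, h₁, h₂⟩ := S.exists_rotation hπ hG ψ (Finset.Icc 1 N)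
    fun μ hμ => (Finset.mem_Icc.1 hμ).1
  have h₃ : ∀ μ : ℤ, N < μ → sectorProj π μ ((U : E →L[ℂ] E) ψ) = 0 := fun μ hμ => by
    rw [h₂ μ fun h => (Finset.mem_Icc.1 h).2.not_gt hμ, hψ μ hμ]
  refine ⟨U, hU, fun μ hμ => ?_, fun μ _ => h₃ μ⟩
  by_cases h : μ ≤ N
  · exact h₁ μ (Finset.mem_Icc.2 ⟨hμ, h⟩)
  · rw [S.Xplus_apply, h₃ μ (not_le.1 h), map_zero]

variable {S} {A : E →ₗ.[ℂ] E}

/-- After the rotation the vector is `F φ` plus its `X₊^(μ)` components with `2 ≤ μ ≤ N + 1`. The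
quarter period shifts each of the latter to charge `μ - 1`. On `F φ` only invariance is known, which
is enough because charges in the range of `F` are at most `1 ≤ N`. -/
theorem IsCompl.exists_lowering (hS : S.IsCompl A) (hA : IsSelfAdjoint A)
    (hπ : StronglyContinuous π) (hpos : ∀ μ : ℤ, μ < 0 → sector π μ = ⊥)
    (hG : ∀ U ∈ specialUnitary π, U ∈ G) (hGA : ∀ t, expI A t ∈ G) {ψ : E} {N : ℤ} (hN : 1 ≤ N)
    (hψ : ∀ μ : ℤ, N + 1 < μ → sectorProj π μ ψ = 0) :
    ∃ U ∈ G, ∀ μ : ℤ, N < μ → sectorProj π μ ((U : E →L[ℂ] E) ψ) = 0 := by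
  obtain ⟨U, hU, h₁, h₂⟩ := S.exists_rotation_of_bounded hπ hG hψ
  set φ := (U : E →L[ℂ] E) ψ with hφ
  set W := expI A (Real.pi / 2) with hW
  refine ⟨W * U, G.mul_mem (hGA _) hU, fun ν hν => ?_⟩
  change sectorProj π ν ((W : E →L[ℂ] E) φ) = 0
  have hrest : φ - S.F φ = ∑ μ ∈ Finset.Icc 2 (N + 1), S.Xplus μ φ := by
    rw [eq_sum_sectorProj hπ (s := Finset.Icc 2 (N + 1)) (ψ := φ - S.F φ)]
    · refine Finset.sum_congr rfl fun μ hμ => ?_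
      have := Finset.mem_Icc.1 hμ
      rw [map_sub, S.sectorProj_F hπ, if_neg (by omega), if_neg (by omega), sub_zero,
        h₁ μ (by omega)]
    · intro μ hμ
      rw [Finset.mem_Icc, not_and_or] at hμ
      rw [map_sub, S.sectorProj_F hπ]
      split_ifs with h0 h1
      · rw [h0, sub_self]
      · rw [h1, h₁ 1 le_rfl, sub_self]
      · rw [sub_zero]
        rcases lt_or_ge μ 0 with h | h
        · exact sectorProj_eq_zero_of_neg hpos h φ
        · exact h₂ μ (by omega) (by omega)
  have hdec : φ = S.F φ + ∑ μ ∈ Finset.Icc 2 (N + 1), S.Xplus μ φ := by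
    rw [← hrest, add_sub_cancel]
  have hF : S.F ((W : E →L[ℂ] E) (S.F φ)) = (W : E →L[ℂ] E) (S.F φ) :=
    hS.lowGroup_invariant W (Subgroup.subset_closure (Or.inl ⟨_, rfl⟩)) _ (S.F_F hπ φ)
  rw [hdec, map_add, map_add, ← hF, S.sectorProj_F hπ, if_neg (by omega), if_neg (by omega),
    zero_add, map_sum, map_sum]
  refine Finset.sum_eq_zero fun μ hμ => ?_
  have hμ' := Finset.mem_Icc.1 hμ
  have := hS.expI_half_pi_Xplus_mem hA hπ hpos (μ := μ - 1) (by omega) φ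
  rw [sub_add_cancel] at this
  exact sectorProj_eq_zero hπ (by omega) this

/-- The descent stops at charge 1, hence the offset in the bound. There one last rotation into
`X₊^(1)` places the vector in the range of `F`. -/
theorem IsCompl.exists_F_eq (hS : S.IsCompl A) (hA : IsSelfAdjoint A)
    (hπ : StronglyContinuous π) (hpos : ∀ μ : ℤ, μ < 0 → sector π μ = ⊥)
    (hG : ∀ U ∈ specialUnitary π, U ∈ G) (hGA : ∀ t, expI A t ∈ G) (N : ℕ) :
    ∀ ψ : E, (∀ μ : ℤ, (N : ℤ) + 1 < μ → sectorProj π μ ψ = 0) →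
      ∃ U ∈ G, S.F ((U : E →L[ℂ] E) ψ) = (U : E →L[ℂ] E) ψ := by
  induction N with
  | zero =>
    intro ψ hψ
    obtain ⟨U, hU, h₁, h₂⟩ := S.exists_rotation_of_bounded hπ hG (N := 1) (by simpa using hψ)
    refine ⟨U, hU, eq_of_forall_sectorProj_eq hπ fun μ => ?_⟩
    rw [S.sectorProj_F hπ]
    split_ifs with h0 h1
    · rw [h0]
    · rw [h1, h₁ 1 le_rfl]
    · rcases lt_or_ge μ 0 with h | h
      · rw [sectorProj_eq_zero_of_neg hpos h]
      · rw [h₂ μ (by omega) (by omega)]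
  | succ N ih =>
    intro ψ hψ
    obtain ⟨U, hU, h⟩ := hS.exists_lowering hA hπ hpos hG hGA (N := N + 1) (by omega)
      (fun μ hμ => hψ μ (by push_cast; exact hμ))
    obtain ⟨W, hW, hF⟩ := ih _ h
    exact ⟨W * U, G.mul_mem hW hU, hF⟩

theorem IsCompl.exists_apply_eq (hS : S.IsCompl A) (hA : IsSelfAdjoint A)
    (hπ : StronglyContinuous π) (hpos : ∀ μ : ℤ, μ < 0 → sector π μ = ⊥)
    (hG : ∀ U ∈ specialUnitary π, U ∈ G) (hGA : ∀ t, expI A t ∈ G)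
    (hGid : ∀ t, expI (idOp : E →ₗ.[ℂ] E) t ∈ G) {χ : E} (hχ : ‖χ‖ = 1) (hχF : S.F χ = χ) {ψ : E}
    (hψ : IsFiniteParticle π ψ) :
    ∃ U ∈ G, (U : E →L[ℂ] E) ψ = (‖ψ‖ : ℂ) • χ := by
  obtain rfl | hψ0 := eq_or_ne ψ 0
  · exact ⟨1, G.one_mem, by simp⟩
  obtain ⟨N, hN⟩ := exists_forall_sectorProj_eq_zero hψ
  obtain ⟨U, hU, hUF⟩ := hS.exists_F_eq hA hπ hpos hG hGA N ψ fun μ hμ => hN μ (by omega)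
  have hn : (‖ψ‖ : ℂ) ≠ 0 := Complex.ofReal_ne_zero.2 (norm_ne_zero_iff.2 hψ0)
  have hlow : S.lowGroup A ≤ G := by
    refine (Subgroup.closure_le G).2 (Set.union_subset ?_ fun W hW => hG W hW.1)
    rintro _ ⟨t, rfl⟩
    exact hGA t
  obtain ⟨W, hW, c, hc, hWc⟩ := hS.lowGroup_transitive
    ((‖ψ‖ : ℂ)⁻¹ • (U : E →L[ℂ] E) ψ) χ
    (by rw [norm_smul, norm_unitary_apply, norm_inv, Complex.norm_real, norm_norm,
      inv_mul_cancel₀ (norm_ne_zero_iff.2 hψ0)]) hχ (by rw [map_smul, hUF]) hχF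
  -- Transitivity on lines leaves the phase `c`; the identity Hamiltonian cancels it.
  refine ⟨expI idOp (-c.arg) * (W * U), G.mul_mem (hGid _) (G.mul_mem (hlow hW) hU), ?_⟩
  change (expI (idOp : E →ₗ.[ℂ] E) (-c.arg) : E →L[ℂ] E) ((W : E →L[ℂ] E) ((U : E →L[ℂ] E) ψ)) = _
  have hWc' : (W : E →L[ℂ] E) ((U : E →L[ℂ] E) ψ) = ((‖ψ‖ : ℂ) * c) • χ := by
    rw [map_smul, inv_smul_eq_iff₀ hn, smul_smul] at hWc
    exact hWc
  have hcarg : c = Complex.exp (c.arg * Complex.I) := by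
    have := Complex.norm_mul_exp_arg_mul_I c
    rw [hc] at this
    simpa using this.symm
  rw [hWc', expI_idOp_apply, smul_smul]
  congr 1
  nth_rewrite 2 [hcarg]
  rw [mul_left_comm, ← Complex.exp_add]
  have : Complex.I * ((-c.arg : ℝ) : ℂ) + c.arg * Complex.I = 0 := by push_cast; ring
  rw [this, Complex.exp_zero, mul_one]

end Splitting

end Steering

theorem norm_sub_lt_of_half {F : Type*} [NormedAddCommGroup F] {x y z : F} {ε : ℝ}
    (h₁ : ‖x - y‖ < ε / 2) (h₂ : ‖y - z‖ < ε / 2) :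
    ‖x - z‖ < ε :=
  (norm_sub_le_norm_sub_add_norm_sub x y z).trans_lt (by linarith)

/-! ### The strong closure of a group of unitaries -/

/-- The closure of a group of unitaries in the strong operator topology of the unitary group. -/
def strongClosure (P : Subgroup (unitary (E →L[ℂ] E))) : Subgroup (unitary (E →L[ℂ] E)) where
  carrier := {U | ∀ (s : Finset E) (ε : ℝ), 0 < ε →
    ∃ V ∈ P, ∀ ψ ∈ s, ‖(V : E →L[ℂ] E) ψ - (U : E →L[ℂ] E) ψ‖ < ε}
  one_mem' s ε hε := ⟨1, P.one_mem, fun ψ _ => by simpa using hε⟩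
  mul_mem' := by
    classical
    intro U₁ U₂ h₁ h₂ s ε hε
    obtain ⟨V₂, hV₂, e₂⟩ := h₂ s (ε / 2) (half_pos hε)
    -- `U₁` is approximated at the vectors `U₂ ψ`; the error of `V₂` passes unchanged through the
    -- isometry `V₁`.
    obtain ⟨V₁, hV₁, e₁⟩ := h₁ (s.image (U₂ : E →L[ℂ] E)) (ε / 2) (half_pos hε)
    refine ⟨V₁ * V₂, P.mul_mem hV₁ hV₂, fun ψ hψ => ?_⟩
    change ‖(V₁ : E →L[ℂ] E) ((V₂ : E →L[ℂ] E) ψ) -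
      (U₁ : E →L[ℂ] E) ((U₂ : E →L[ℂ] E) ψ)‖ < ε
    have e₃ := e₂ ψ hψ
    rw [← norm_unitary_apply V₁, map_sub] at e₃
    have e₄ := e₁ _ (Finset.mem_image_of_mem _ hψ)
    exact norm_sub_lt_of_half e₃ e₄
  inv_mem' := by
    classical
    intro U h s ε hε
    have hinv : ∀ (W : unitary (E →L[ℂ] E)) (ψ : E),
        (W : E →L[ℂ] E) (((W⁻¹ : unitary (E →L[ℂ] E)) : E →L[ℂ] E) ψ) = ψ := fun W ψ =>
      DFunLike.congr_fun (congrArg Subtype.val (mul_inv_cancel W)) ψ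
    -- Testing at `U⁻¹ ψ` works because `‖V⁻¹ ψ - U⁻¹ ψ‖ = ‖ψ - V U⁻¹ ψ‖`.
    obtain ⟨V, hV, e⟩ := h (s.image ((U⁻¹ : unitary (E →L[ℂ] E)) : E →L[ℂ] E)) ε hε
    refine ⟨V⁻¹, P.inv_mem hV, fun ψ hψ => ?_⟩
    have e' := e _ (Finset.mem_image_of_mem _ hψ)
    rw [hinv] at e'
    rwa [← norm_unitary_apply V, map_sub, hinv, norm_sub_rev]

theorem le_strongClosure (P : Subgroup (unitary (E →L[ℂ] E))) : P ≤ strongClosure P :=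
  fun U hU _ ε hε => ⟨U, hU, fun ψ _ => by simpa using hε⟩

theorem isStronglyClosed_strongClosure (P : Subgroup (unitary (E →L[ℂ] E))) :
    IsStronglyClosed (strongClosure P : Set (unitary (E →L[ℂ] E))) := by
  intro U h s ε hε
  obtain ⟨V, hV, e₁⟩ := h s (ε / 2) (half_pos hε)
  obtain ⟨W, hW, e₂⟩ := hV s (ε / 2) (half_pos hε)
  refine ⟨W, hW, fun ψ hψ => ?_⟩
  exact norm_sub_lt_of_half (e₂ ψ hψ) (e₁ ψ hψ)

/-! ### Propagators -/

section Propagators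

variable {ι : Type*} (A : ι → E →ₗ.[ℂ] E)

/-- The group generated, without closure, by the unitary groups of a family of Hamiltonians. -/
def pulseGroup : Subgroup (unitary (E →L[ℂ] E)) :=
  Subgroup.closure (⋃ k, Set.range (expI (A k)))

theorem expI_mem_pulseGroup (k : ι) (t : ℝ) : expI (A k) t ∈ pulseGroup A :=
  Subgroup.subset_closure (Set.mem_iUnion.2 ⟨k, t, rfl⟩)

theorem propagator_append (l₁ l₂ : List (Pulse ι)) :
    propagator A (l₁ ++ l₂) = propagator A l₂ * propagator A l₁ := by
  induction l₁ with
  | nil => simp [propagator]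
  | cons p l ih => simp [propagator, ih, mul_assoc]

theorem propagator_singleton (k : ι) (t : ℝ) :
    propagator A [⟨k, -t, 1, one_pos⟩] = expI (A k) t := by
  simp [propagator]

/-- Amplitudes of either sign are allowed, so a pulse is undone in positive time by reversing its
sign. -/
theorem exists_propagator_inv (l : List (Pulse ι)) :
    ∃ l', propagator A l' = (propagator A l)⁻¹ := by
  induction l with
  | nil => exact ⟨[], by simp [propagator]⟩
  | cons p l ih =>
    obtain ⟨l', h⟩ := ih
    refine ⟨l' ++ [⟨p.index, -(p.duration * p.amplitude), 1, one_pos⟩], ?_⟩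
    rw [propagator_append, propagator_singleton, h, propagator, mul_inv_rev, expI_neg, inv_inv]

theorem exists_propagator_eq {U : unitary (E →L[ℂ] E)} (hU : U ∈ pulseGroup A) :
    ∃ l, propagator A l = U := by
  induction hU using Subgroup.closure_induction with
  | mem U h =>
    obtain ⟨k, t, rfl⟩ := Set.mem_iUnion.1 h
    exact ⟨_, propagator_singleton A k t⟩
  | one => exact ⟨[], rfl⟩
  | mul U V _ _ hU hV =>
    obtain ⟨l₁, rfl⟩ := hU
    obtain ⟨l₂, rfl⟩ := hV
    exact ⟨l₂ ++ l₁, propagator_append A _ _⟩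
  | inv U _ hU =>
    obtain ⟨l, rfl⟩ := hU
    exact exists_propagator_inv A l

theorem exists_propagator_eq_ne_nil [Nonempty ι] {U : unitary (E →L[ℂ] E)}
    (hU : U ∈ pulseGroup A) : ∃ l, l ≠ [] ∧ propagator A l = U := by
  obtain ⟨l, rfl⟩ := exists_propagator_eq A hU
  -- An idle pulse of amplitude zero ensures positive total time.
  refine ⟨⟨Classical.arbitrary ι, 0, 1, one_pos⟩ :: l, List.cons_ne_nil _ _, ?_⟩
  rw [propagator, mul_zero, neg_zero, expI_zero, mul_one]

theorem reachable_of_strongClosure [Nonempty ι] {ψ₀ ψ : E}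
    (h : ∀ ε > 0, ∃ U ∈ strongClosure (pulseGroup A), ‖ψ - (U : E →L[ℂ] E) ψ₀‖ < ε) :
    Reachable A ψ₀ ψ := by
  intro ε hε
  obtain ⟨U, hU, e₁⟩ := h (ε / 2) (half_pos hε)
  obtain ⟨V, hV, e₂⟩ := hU {ψ₀} (ε / 2) (half_pos hε)
  obtain ⟨l, hl, rfl⟩ := exists_propagator_eq_ne_nil A hV
  refine ⟨l, hl, ?_⟩
  have e₃ := e₂ ψ₀ (Finset.mem_singleton_self _)
  rw [norm_sub_rev] at e₃
  exact norm_sub_lt_of_half e₁ e₃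

end Propagators

/-- If a group of unitaries can steer a dense set of vectors to multiples of `χ`, it can
approximately steer every vector to a multiple of `χ`. -/
theorem exists_norm_sub_lt_of_dense {G : Subgroup (unitary (E →L[ℂ] E))} {D : Set E}
    (hD : Dense D) {χ : E} (hχ : ‖χ‖ = 1)
    (h : ∀ φ ∈ D, ∃ U ∈ G, (U : E →L[ℂ] E) φ = (‖φ‖ : ℂ) • χ) (ψ : E) {ε : ℝ} (hε : 0 < ε) :
    ∃ U ∈ G, ‖(U : E →L[ℂ] E) ψ - (‖ψ‖ : ℂ) • χ‖ < ε := by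
  obtain ⟨φ, hφ, hd⟩ := Metric.dense_iff.1 hD ψ (ε / 2) (half_pos hε)
  rw [Metric.mem_ball, dist_eq_norm] at hφ
  obtain ⟨U, hU, e⟩ := h φ hd
  refine ⟨U, hU, ?_⟩
  have e₁ : ‖(U : E →L[ℂ] E) ψ - (U : E →L[ℂ] E) φ‖ < ε / 2 := by
    rwa [← map_sub, norm_unitary_apply, norm_sub_rev]
  have e₂ : ‖(U : E →L[ℂ] E) φ - (‖ψ‖ : ℂ) • χ‖ < ε / 2 := by
    rw [e, ← sub_smul, norm_smul, hχ, mul_one, ← Complex.ofReal_sub, Complex.norm_real,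
      Real.norm_eq_abs]
    exact (abs_norm_sub_norm_le φ ψ).trans_lt hφ
  exact norm_sub_lt_of_half e₁ e₂

end QControl

end

theorem mainTheorem2 {E : Type*} [NormedAddCommGroup E] [InnerProductSpace ℂ E] [CompleteSpace E]
    (π : Circle →* unitary (E →L[ℂ] E)) (hπ : QControl.StronglyContinuous π)
    [∀ μ : ℤ, FiniteDimensional ℂ (QControl.sector π μ)]
    (hpos : ∀ μ : ℤ, μ < 0 → QControl.sector π μ = ⊥)
    (n : ℕ) (A : Fin (n + 1) → E →ₗ.[ℂ] E) (hA : ∀ k, IsSelfAdjoint (A k))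
    (hcomm : ∀ k : Fin n, QControl.CommutesWithCharge π (A k.castSucc))
    (hSU : ∀ U ∈ QControl.specialUnitary π,
      U ∈ QControl.dynamicalGroup fun k : Fin n => A k.castSucc)
    (hcompl : QControl.IsComplementary π (A (Fin.last n))) :
    QControl.PureStateControllable
      (Fin.cons QControl.idOp A : Fin (n + 2) → E →ₗ.[ℂ] E) := by
  obtain ⟨S, hS⟩ := hcompl
  set A' : Fin (n + 2) → E →ₗ.[ℂ] E := Fin.cons QControl.idOp A with hA'
  set G := QControl.strongClosure (QControl.pulseGroup A') with hGdef
  have hexp : ∀ k t, QControl.expI (A' k) t ∈ G := fun k t =>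
    QControl.le_strongClosure _ (QControl.expI_mem_pulseGroup A' k t)
  have hGA : ∀ k t, QControl.expI (A k) t ∈ G := fun k t => by simpa [hA'] using hexp k.succ t
  have hGid : ∀ t, QControl.expI QControl.idOp t ∈ G := fun t => by simpa [hA'] using hexp 0 t
  -- `G` is one of the strongly closed groups whose intersection defines the dynamical group.
  have hG : ∀ U ∈ QControl.specialUnitary π, U ∈ G := fun U hU =>
    Subgroup.mem_sInf.1 (hSU U hU) G
      ⟨QControl.isStronglyClosed_strongClosure _, fun k t => hGA k.castSucc t⟩
  obtain ⟨χ, hχ, hχF⟩ := S.exists_norm_eq_one_F_eq hπ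
  have hsteer := QControl.exists_norm_sub_lt_of_dense (QControl.dense_finiteParticle hπ) hχ
    fun φ hφ => hS.exists_apply_eq (hA _) hπ hpos hG (hGA _) hGid hχ hχF hφ
  intro ψ₀ ψ h₀ h₁
  refine QControl.reachable_of_strongClosure A' fun ε hε => ?_
  obtain ⟨U₀, hU₀, e₀⟩ := hsteer ψ₀ (half_pos hε)
  obtain ⟨U₁, hU₁, e₁⟩ := hsteer ψ (half_pos hε)
  -- Steer `ψ₀` near `χ`, then run the steering of `ψ` backwards; applying the isometry `U₁`
  -- compares both errors at `χ`.
  refine ⟨U₁⁻¹ * U₀, G.mul_mem (G.inv_mem hU₁) hU₀, ?_⟩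
  rw [h₀] at e₀
  rw [h₁] at e₁
  have hmul : (U₁ : E →L[ℂ] E) (((U₁⁻¹ * U₀ : unitary (E →L[ℂ] E)) : E →L[ℂ] E) ψ₀) =
      (U₀ : E →L[ℂ] E) ψ₀ :=
    DFunLike.congr_fun (congrArg Subtype.val (mul_inv_cancel_left U₁ U₀)) ψ₀
  rw [← QControl.norm_unitary_apply U₁, map_sub, hmul]
  rw [norm_sub_rev] at e₀
  exact QControl.norm_sub_lt_of_half e₁ e₀
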